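/- Let $l$ be a positive integer and $\mathfrak{gl}_2=\mathfrak{gl}_2(\mathbb{C})$, with matrix units $E_{ij}$ and universal enveloping algebra $U(\mathfrak{gl}_2)$. Let $X=(x_{ij})_{1\le i,j\le 2}$ be a matrix of indeterminates, and let $U(\mathfrak{gl}_2)$ act on the polynomial ring $\mathbb{C}[x_{11},x_{12},x_{21},x_{22}]$ by $$E_{ij}\cdot f=\sum_{k=1}^{2}x_{ik}\frac{\partial f}{\partial x_{jk}}.$$ For a polynomial $f$, $U(\mathfrak{gl}_2)\cdot f$ denotes the cyclic submodule generated by $f$. For $\alpha\in\mathbb{C}$ let $$\det{}^{(\alpha)}(X)=\sum_{\sigma\in\mathfrak{S}_2}\alpha^{\nu(\sigma)}x_{\sigma(1)1}x_{\sigma(2)2}=x_{11}x_{22}+\alpha\,x_{21}x_{12},$$ where $\nu(\sigma)$ is $2$ minus the number of cycles of $\sigma$; in particular $\det^{(1)}(X)=\operatorname{per}(X)$ and $\det^{(-1)}(X)=\det(X)$. Let $\mathbb{C}^2$ be the natural representation of $\mathfrak{gl}_2$, let symmetric powers and tensor products carry the induced actions, and let $\mathcal{M}_2^{(a,b)}$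 denote the irreducible highest weight $U(\mathfrak{gl}_2)$-module of highest weight $(a,b)$. All isomorphisms below are isomorphisms of $U(\mathfrak{gl}_2)$-modules. (1) For every $\alpha\in\mathbb{C}$ with $|\alpha|\ne1$, $$U(\mathfrak{gl}_2)\cdot\det{}^{(\alpha)}(X)^l\;\cong\;\operatorname{Sym}^l(\mathbb{C}^2)^{\otimes2}\;\cong\;\bigoplus_{s=0}^{l}\mathcal{M}_2^{(2l-s,\,s)}.$$ (2) For the permanent ($\alpha=1$), $$U(\mathfrak{gl}_2)\cdot\operatorname{per}(X)^l\;\cong\;\bigoplus_{j=0}^{\lfloor l/2\rfloor}\mathcal{M}_2^{(2l-2j,\,2j)}\;\cong\;\operatorname{Sym}^l\bigl(\operatorname{Sym}^2(\mathbb{C}^2)\bigr).$$ (3) For the determinant ($\alpha=-1$), $$U(\mathfrak{gl}_2)\cdot\det(X)^l\;=\;\mathbb{C}\cdot\det(X)^l\;\cong\;\mathcal{M}_2^{(l,l)}.$$ -/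

import Mathlib

open scoped TensorProduct DirectSum

/- The commutator bracket on an associative ring. -/
attribute [local instance 100] LieRing.ofAssociativeRing

noncomputable section

namespace AlphaDet

/-! ### The Lie algebra, cyclic modules -/

/-- The Lie algebra `gl_n(ℂ)`: complex `n × n` matrices with the commutator bracket. -/
abbrev Gl (n : ℕ) : Type := Matrix (Fin n) (Fin n) ℂ

/-- The universal enveloping algebra `U(gl_n)`. -/
abbrev Ugl (n : ℕ) : Type := UniversalEnvelopingAlgebra ℂ (Gl n)

/-- The algebra homomorphism `U(gl_n) → End(M)` attached to a `gl_n`-module `M`. -/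
def uAct (n : ℕ) (M : Type) [AddCommGroup M] [Module ℂ M] [LieRingModule (Gl n) M]
    [LieModule ℂ (Gl n) M] : Ugl n →ₐ[ℂ] Module.End ℂ M :=
  UniversalEnvelopingAlgebra.lift ℂ (LieModule.toEnd ℂ (Gl n) M)

/-- The cyclic submodule `U(gl_n) · m = {u · m | u ∈ U(gl_n)}` of `M`. -/
def cyclic (n : ℕ) {M : Type} [AddCommGroup M] [Module ℂ M] [LieRingModule (Gl n) M]
    [LieModule ℂ (Gl n) M] (m : M) : LieSubmodule ℂ (Gl n) M where
  toSubmodule := LinearMap.range ((LinearMap.applyₗ m).comp (uAct n M).toLinearMap)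
  lie_mem := by
    rintro x _ ⟨u, rfl⟩
    refine ⟨UniversalEnvelopingAlgebra.ι ℂ x * u, ?_⟩
    simp [uAct]

/-! ### Polynomials on matrices and the `α`-determinant -/

/-- The polynomial algebra in the matrix entries `x_{ij}`, where `x_{ij}` is `X (i, j)`. -/
abbrev PolyMat (n : ℕ) : Type := MvPolynomial (Fin n × Fin n) ℂ

/-- The derivation `∑_{i,j} A_{ij} ∑_k x_{ik} ∂/∂x_{jk}` by which `A = ∑ A_{ij} E_{ij}` acts. -/
def polarization (n : ℕ) (A : Gl n) : Derivation ℂ (PolyMat n) (PolyMat n) :=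
  ∑ i, ∑ j, A i j • ∑ k, (MvPolynomial.X (i, k) : PolyMat n) • MvPolynomial.pderiv (j, k)

theorem polarization_apply (n : ℕ) (A : Gl n) (f : PolyMat n) :
    polarization n A f =
      ∑ i, ∑ j, A i j • ∑ k, MvPolynomial.X (i, k) * MvPolynomial.pderiv (j, k) f := by
  have hs : ∀ g : Fin n → Derivation ℂ (PolyMat n) (PolyMat n), (∑ i, g i) f = ∑ i, g i f := by
    intro g
    have h := congrFun (map_sum (Derivation.coeFnAddMonoidHom (R := ℂ) (A := PolyMat n)
      (M := PolyMat n)) g Finset.univ) f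
    simpa only [Derivation.coeFnAddMonoidHom, AddMonoidHom.coe_mk, ZeroHom.coe_mk,
      Finset.sum_apply] using h
  simp only [polarization, hs, Derivation.smul_apply, smul_eq_mul]

theorem polarization_X (n : ℕ) (A : Gl n) (p q : Fin n) :
    polarization n A (MvPolynomial.X (p, q)) = ∑ i, A i p • (MvPolynomial.X (i, q) : PolyMat n) := by
  classical
  rw [polarization_apply]
  refine Finset.sum_congr rfl fun i _ => ?_
  rw [Finset.sum_eq_single p]
  · rw [Finset.sum_eq_single q]
    · simp
    · intro k _ hk
      rw [MvPolynomial.pderiv_X_of_ne (by simp [hk.symm]), mul_zero]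
    · simp
  · intro j _ hj
    rw [Finset.sum_eq_zero, smul_zero]
    intro k _
    rw [MvPolynomial.pderiv_X_of_ne (by simp [hj.symm]), mul_zero]
  · simp

/-- `gl_n` acts on polynomials by `E_{ij} f = ∑_k x_{ik} ∂f/∂x_{jk}`. -/
instance instLieRingModulePolyMat (n : ℕ) : LieRingModule (Gl n) (PolyMat n) where
  bracket A f := polarization n A f
  add_lie A B f := by
    change polarization n (A + B) f = polarization n A f + polarization n B f
    simp only [polarization_apply, Matrix.add_apply, add_smul, Finset.sum_add_distrib]
  lie_add A f g := map_add _ f g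
  leibniz_lie A B f := by
    have h : polarization n ⁅A, B⁆ = ⁅polarization n A, polarization n B⁆ := by
      refine MvPolynomial.derivation_ext ?_
      rintro ⟨p, q⟩
      have key : ∀ C D : Gl n, polarization n C (∑ i, D i p • (MvPolynomial.X (i, q) : PolyMat n))
          = ∑ i, (C * D) i p • (MvPolynomial.X (i, q) : PolyMat n) := by
        intro C D
        simp only [map_sum, Derivation.map_smul, polarization_X, Finset.smul_sum, smul_smul,
          Matrix.mul_apply, Finset.sum_smul]
        rw [Finset.sum_comm]
        simp only [mul_comm]
      rw [Derivation.commutator_apply, polarization_X, polarization_X, polarization_X, key, key,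
        ← Finset.sum_sub_distrib]
      refine Finset.sum_congr rfl fun i _ => ?_
      rw [← sub_smul, Ring.lie_def, Matrix.sub_apply]
    have h2 := congrArg (fun D => D f) h
    simp only [Derivation.commutator_apply] at h2
    rw [h2]
    abel

instance instLieModulePolyMat (n : ℕ) : LieModule ℂ (Gl n) (PolyMat n) where
  smul_lie t A f := by
    change polarization n (t • A) f = t • polarization n A f
    simp only [polarization_apply, Matrix.smul_apply, smul_assoc, Finset.smul_sum]
  lie_smul t A f := (polarization n A).map_smul t f

/-- `ν(σ)`: `n` minus the number of cycles of `σ`, fixed points being counted as cycles. -/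
def nu {n : ℕ} (σ : Equiv.Perm (Fin n)) : ℕ := n - σ.partition.parts.card

/-- The `α`-determinant `∑_σ α^{ν(σ)} x_{σ(1)1} ⋯ x_{σ(n)n}` of a square matrix. -/
def alphaDet {R : Type} [CommRing R] [Algebra ℂ R] {n : ℕ} (α : ℂ)
    (X : Matrix (Fin n) (Fin n) R) : R :=
  ∑ σ : Equiv.Perm (Fin n), α ^ nu σ • ∏ i, X (σ i) i

/-- The generic matrix `X = (x_{ij})`. -/
abbrev genX (n : ℕ) : Matrix (Fin n) (Fin n) (PolyMat n) :=
  Matrix.mvPolynomialX (Fin n) (Fin n) ℂ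

/-! ### Symmetric powers -/

section Sym

variable (n : ℕ) (V : Type) [AddCommGroup V] [Module ℂ V] [LieRingModule (Gl n) V]
  [LieModule ℂ (Gl n) V]

/-- The algebra homomorphism `v ↦ v + ε (A v)` into the dual numbers over `Sym(V)`. -/
def symDualHom (A : Gl n) :
    SymmetricAlgebra ℂ V →ₐ[ℂ] TrivSqZeroExt (SymmetricAlgebra ℂ V) (SymmetricAlgebra ℂ V) :=
  SymmetricAlgebra.lift
    ((TrivSqZeroExt.inlAlgHom ℂ (SymmetricAlgebra ℂ V) (SymmetricAlgebra ℂ V)).toLinearMap.comp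
        (SymmetricAlgebra.ι ℂ V) +
      ((TrivSqZeroExt.inrHom (SymmetricAlgebra ℂ V)
          (SymmetricAlgebra ℂ V)).restrictScalars ℂ).comp
        ((SymmetricAlgebra.ι ℂ V).comp (LieModule.toEnd ℂ (Gl n) V A)))

theorem symDualHom_fst (A : Gl n) (a : SymmetricAlgebra ℂ V) :
    (symDualHom n V A a).fst = a := by
  have h : (TrivSqZeroExt.fstHom ℂ (SymmetricAlgebra ℂ V) (SymmetricAlgebra ℂ V)).comp
      (symDualHom n V A) = AlgHom.id ℂ _ := by
    refine SymmetricAlgebra.algHom_ext (LinearMap.ext fun v => ?_)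
    simp [symDualHom]
  exact congrArg (fun g => g a) h

/-- The unique derivation of the symmetric algebra of `V` extending the action of `A` on `V`. -/
def symDer (A : Gl n) : Derivation ℂ (SymmetricAlgebra ℂ V) (SymmetricAlgebra ℂ V) :=
  Derivation.mk'
    (((TrivSqZeroExt.sndHom (SymmetricAlgebra ℂ V)
        (SymmetricAlgebra ℂ V)).restrictScalars ℂ).comp (symDualHom n V A).toLinearMap)
    (by
      intro a b
      simp [symDualHom_fst, mul_comm])

@[simp]
theorem symDer_ι (A : Gl n) (v : V) :
    symDer n V A (SymmetricAlgebra.ι ℂ V v) = SymmetricAlgebra.ι ℂ V ⁅A, v⁆ := by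
  simp [symDer, symDualHom]

variable {n V} in
theorem symDer_ext {D E : Derivation ℂ (SymmetricAlgebra ℂ V) (SymmetricAlgebra ℂ V)}
    (h : ∀ v, D (SymmetricAlgebra.ι ℂ V v) = E (SymmetricAlgebra.ι ℂ V v)) : D = E := by
  ext a
  induction a using SymmetricAlgebra.induction with
  | algebraMap r => simp
  | ι x => exact h x
  | mul a b ha hb => simp [ha, hb]
  | add a b ha hb => simp [ha, hb]

/-- `gl_n` acts on the symmetric algebra of a module by derivations. -/
instance instLieRingModuleSym : LieRingModule (Gl n) (SymmetricAlgebra ℂ V) where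
  bracket A f := symDer n V A f
  add_lie A B f := by
    have h : symDer n V (A + B) = symDer n V A + symDer n V B :=
      symDer_ext fun v => by simp
    exact congrArg (fun D => D f) h
  lie_add A f g := map_add _ f g
  leibniz_lie A B f := by
    have h : symDer n V ⁅A, B⁆ = ⁅symDer n V A, symDer n V B⁆ :=
      symDer_ext fun v => by simp [Derivation.commutator_apply]
    have h2 := congrArg (fun D => D f) h
    simp only [Derivation.commutator_apply] at h2
    rw [h2]
    abel

instance instLieModuleSym : LieModule ℂ (Gl n) (SymmetricAlgebra ℂ V) where
  smul_lie t A f := by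
    have h : symDer n V (t • A) = t • symDer n V A :=
      symDer_ext fun v => by simp
    exact congrArg (fun D => D f) h
  lie_smul t A f := (symDer n V A).map_smul t f

/-- The symmetric power `Sym^l(V)`: the degree `l` part of the symmetric algebra, spanned by the
products of `l` elements of `V`, with the induced action of `gl_n`. -/
def SymPow (l : ℕ) : LieSubmodule ℂ (Gl n) (SymmetricAlgebra ℂ V) where
  toSubmodule := LinearMap.range (SymmetricAlgebra.ι ℂ V) ^ l
  lie_mem := by
    intro A m hm
    change symDer n V A m ∈ LinearMap.range (SymmetricAlgebra.ι ℂ V) ^ l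
    change m ∈ LinearMap.range (SymmetricAlgebra.ι ℂ V) ^ l at hm
    induction hm using Submodule.pow_induction_on_left' with
    | algebraMap r => simp
    | add x y i _ _ hx hy => rw [map_add]; exact add_mem hx hy
    | mem_mul v hv i x hx ih =>
      obtain ⟨w, rfl⟩ := hv
      rw [Derivation.leibniz, symDer_ι, smul_eq_mul, smul_eq_mul, pow_succ']
      refine add_mem (Submodule.mul_mem_mul (LinearMap.mem_range_self _ w) ih) ?_
      rw [mul_comm x]
      exact Submodule.mul_mem_mul (LinearMap.mem_range_self _ _) hx

end Sym

/-- The natural representation `ℂ^n`, on which a matrix acts by matrix-vector multiplication. -/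
abbrev Nat1 (n : ℕ) : Type := Fin n → ℂ

/-! ### Irreducible highest weight modules -/

/-- The left ideal of `U(gl_n)` generated by `E_{ij}` (`i < j`) and `E_{ii} - w_i`. The quotient
of `U(gl_n)` by it is the Verma module of highest weight `w`. -/
def vermaIdeal (n : ℕ) (w : Fin n → ℂ) : Submodule (Ugl n) (Ugl n) :=
  Submodule.span (Ugl n)
    ({u | ∃ i j : Fin n, i < j ∧
        u = UniversalEnvelopingAlgebra.ι ℂ (Matrix.single i j (1 : ℂ) : Gl n)} ∪
      {u | ∃ i : Fin n,
        u = UniversalEnvelopingAlgebra.ι ℂ (Matrix.single i i (1 : ℂ) : Gl n) -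
          algebraMap ℂ (Ugl n) (w i)})

/-- The sum of all proper left ideals of `U(gl_n)` containing `vermaIdeal n w`; it corresponds to
the largest proper submodule of the Verma module. -/
def maxIdeal (n : ℕ) (w : Fin n → ℂ) : Submodule (Ugl n) (Ugl n) :=
  sSup {N | vermaIdeal n w ≤ N ∧ N ≠ ⊤}

/-- The irreducible highest weight module of `gl_n` with highest weight `w`: the quotient of the
Verma module of highest weight `w` by its largest proper submodule. -/
def HW (n : ℕ) (w : Fin n → ℂ) : Type := Ugl n ⧸ maxIdeal n w

instance (n : ℕ) (w : Fin n → ℂ) : AddCommGroup (HW n w) :=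
  inferInstanceAs (AddCommGroup (Ugl n ⧸ maxIdeal n w))

instance (n : ℕ) (w : Fin n → ℂ) : Module (Ugl n) (HW n w) :=
  inferInstanceAs (Module (Ugl n) (Ugl n ⧸ maxIdeal n w))

instance (n : ℕ) (w : Fin n → ℂ) : Module ℂ (HW n w) :=
  inferInstanceAs (Module ℂ (Ugl n ⧸ maxIdeal n w))

instance (n : ℕ) (w : Fin n → ℂ) : IsScalarTower ℂ (Ugl n) (HW n w) :=
  inferInstanceAs (IsScalarTower ℂ (Ugl n) (Ugl n ⧸ maxIdeal n w))

/-- An element of `gl_n` acts on `HW n w` by left multiplication in `U(gl_n)`. -/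
instance (n : ℕ) (w : Fin n → ℂ) : LieRingModule (Gl n) (HW n w) where
  bracket A q := UniversalEnvelopingAlgebra.ι ℂ A • q
  add_lie A B q := by
    change UniversalEnvelopingAlgebra.ι ℂ (A + B) • q = _
    rw [map_add, add_smul]
  lie_add A q r := smul_add _ q r
  leibniz_lie A B q := by
    change UniversalEnvelopingAlgebra.ι ℂ A • UniversalEnvelopingAlgebra.ι ℂ B • q =
      UniversalEnvelopingAlgebra.ι ℂ ⁅A, B⁆ • q +
        UniversalEnvelopingAlgebra.ι ℂ B • UniversalEnvelopingAlgebra.ι ℂ A • q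
    rw [LieHom.map_lie, LieRing.of_associative_ring_bracket, sub_smul, mul_smul, mul_smul]
    abel

instance (n : ℕ) (w : Fin n → ℂ) : LieModule ℂ (Gl n) (HW n w) where
  smul_lie t A q := by
    change UniversalEnvelopingAlgebra.ι ℂ (t • A) • q = t • UniversalEnvelopingAlgebra.ι ℂ A • q
    rw [map_smul, smul_assoc]
  lie_smul t A q := by
    change UniversalEnvelopingAlgebra.ι ℂ A • t • q = t • UniversalEnvelopingAlgebra.ι ℂ A • q
    rw [← algebraMap_smul (Ugl n) t q, ← algebraMap_smul (Ugl n) t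
      (UniversalEnvelopingAlgebra.ι ℂ A • q), ← mul_smul, ← mul_smul, Algebra.commutes]

/-- The `gl_2`-module `M_2^{(a,b)}`. -/
abbrev M2 (a b : ℂ) : Type := HW 2 ![a, b]

/-- Two `gl_n`-modules (equivalently `U(gl_n)`-modules) are isomorphic: there is a linear
bijection commuting with the action of every element of `U(gl_n)`. -/
def UIso (n : ℕ) (M N : Type) [AddCommGroup M] [Module ℂ M] [LieRingModule (Gl n) M]
    [LieModule ℂ (Gl n) M] [AddCommGroup N] [Module ℂ N] [LieRingModule (Gl n) N]
    [LieModule ℂ (Gl n) N] : Prop :=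
  ∃ e : M ≃ₗ[ℂ] N, ∀ (u : Ugl n) (m : M), e (uAct n M u m) = uAct n N u (e m)

end AlphaDet

end

open AlphaDet

/-! Polynomials homogeneous of degree `l` in each column form a copy of `Sym^l ⊗ Sym^l`. It contains
the highest weight vectors `v_s = (x_11 x_12)^(l-s) det^s` of weight `(2l-s, s)`, generating
irreducible modules of dimension `2(l-s)+1`. These dimensions add up to `(l+1)^2`, so a dimension
count shows that the `v_s` account for the whole tensor square (`tensorHom_range_and_uIso`). The
same count with even `s` handles `Sym^l(Sym^2)`, realised as the degree `l` polynomials in `x_11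
x_12`, `x_21 x_22` and the permanent (`symPowHom_range_and_uIso`).

It remains to decide which `v_s` lie in the cyclic module of the `l`-th power of the
`α`-determinant. The Casimir element separates the components, so `v_s` lies there as soon as the
`s`-component of the power is nonzero. This is tested with the apolar form, for which `E_ij` and
`E_ji` are adjoint (`IsDominantFamily.mem_cyclic_of_pairing`). With `n = l - s`, pairing the power
with `E_21^n v_s` moves the operator across to `E_12^n`, which turns the power into a multiple of
`(1+α)^n (x_11 x_12)^n (det^(α))^s`. The outcome is a nonzero constant times `(1+α)^n` times the
coefficient of `t^s` in `((1+αt)(1-t))^(-(n+1))`, a rescaled Gegenbauer polynomial in `α`.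

All zeros of that polynomial lie on `|α| = 1`, which gives the generic case
(`coeff_gegenbauerSeries_ne_zero`). At `α = 1` the series is `(1-t^2)^(-(n+1))`, whose even
coefficients are nonzero. At `α = -1` the power is itself the highest weight vector `v_l`, of weight
`(l, l)`. -/

noncomputable section

namespace AlphaDet

/-! ### Zeros of the Gegenbauer coefficients -/

/-- The power series `(1 - β t)^{-(r+1)}`. -/
def invPowSeries (r : ℕ) (β : ℂ) : PowerSeries ℂ :=
  PowerSeries.mk fun i => ((r + i).choose r : ℂ) * β ^ i

/-- The logarithmic derivative of `(1-βt)^(-(r+1))` is `(r+1)β/(1-βt)`; on coefficients this is the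
absorption identity `key`. -/
theorem invPowSeries_ode (r : ℕ) (β : ℂ) :
    (1 - PowerSeries.C β * PowerSeries.X) * PowerSeries.derivative ℂ (invPowSeries r β) =
      PowerSeries.C ((r + 1) * β) * invPowSeries r β := by
  ext m
  have key : ∀ i : ℕ, ((i : ℂ) + 1) * ((r + (i + 1)).choose r : ℂ)
      = (r + i + 1) * ((r + i).choose r : ℂ) := by
    intro i
    have h1 := Nat.add_one_mul_choose_eq (r + i) i
    have h2 : (r + (i + 1)).choose r = (r + i).succ.choose i.succ := by
      rw [← Nat.choose_symm_of_eq_add (n := r + (i + 1)) (a := i + 1) (b := r) (by ring)]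
      rfl
    have h3 : (r + i).choose r = (r + i).choose i :=
      Nat.choose_symm_add
    rw [h2, h3]
    have := congrArg (Nat.cast (R := ℂ)) h1
    push_cast at this ⊢
    linear_combination -this
  rw [sub_mul, one_mul, mul_assoc, map_sub, PowerSeries.coeff_C_mul, PowerSeries.coeff_C_mul]
  cases m with
  | zero =>
    have := key 0
    simp [invPowSeries, PowerSeries.coeff_derivative] at this ⊢
  | succ m =>
    have h := key (m + 1)
    simp only [PowerSeries.coeff_succ_X_mul, PowerSeries.coeff_derivative, invPowSeries,
      PowerSeries.coeff_mk]
    push_cast at h ⊢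
    linear_combination (β ^ (m + 2)) * h

/-- The power series `((1 - β t)(1 - t))^{-(r+1)}`, whose coefficients are rescaled Gegenbauer
polynomials. -/
def gegenbauerSeries (r : ℕ) (β : ℂ) : PowerSeries ℂ := invPowSeries r β * invPowSeries r 1

theorem coeff_gegenbauerSeries (r m : ℕ) (β : ℂ) :
    PowerSeries.coeff m (gegenbauerSeries r β) =
      ∑ k ∈ Finset.range (m + 1),
        ((r + k).choose r : ℂ) * ((r + (m - k)).choose r : ℂ) * β ^ k := by
  rw [gegenbauerSeries, PowerSeries.coeff_mul, Finset.Nat.sum_antidiagonal_eq_sum_range_succ_mk]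
  refine Finset.sum_congr rfl fun k _ => ?_
  simp [invPowSeries]
  ring

theorem gegenbauerSeries_ode (r : ℕ) (β : ℂ) :
    (1 - PowerSeries.C β * PowerSeries.X) * (1 - PowerSeries.X) *
        PowerSeries.derivative ℂ (gegenbauerSeries r β) =
      PowerSeries.C (r + 1 : ℂ) * (PowerSeries.C β * (1 - PowerSeries.X) +
        (1 - PowerSeries.C β * PowerSeries.X)) * gegenbauerSeries r β := by
  have h1 := invPowSeries_ode r β
  have h2 := invPowSeries_ode r 1
  rw [gegenbauerSeries, Derivation.leibniz]
  simp only [smul_eq_mul, map_mul, map_one, one_mul, mul_one] at *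
  linear_combination (1 - PowerSeries.X) * invPowSeries r 1 * h1 +
    (1 - PowerSeries.C β * PowerSeries.X) * invPowSeries r β * h2

/-- The differences `c_m - β c_{m-1}` and `c_m - c_{m-1}` of consecutive coefficients of the
Gegenbauer series satisfy a linear recurrence. -/
theorem gegenbauerSeries_recurrence (r : ℕ) (β : ℂ) (m : ℕ) :
    let a := fun m => PowerSeries.coeff m
      ((1 - PowerSeries.C β * PowerSeries.X) * gegenbauerSeries r β)
    let b := fun m => PowerSeries.coeff m ((1 - PowerSeries.X) * gegenbauerSeries r β)
    (m + 1) * a (m + 1) = (m + r + 1) * a m + r * (β * b m) ∧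
      (m + 1) * b (m + 1) = r * a m + (m + r + 1) * (β * b m) := by
  intro a b
  set G := gegenbauerSeries r β with hG
  have h := gegenbauerSeries_ode r β
  rw [← hG] at h
  -- Multiplying `G` by `1-βt` lowers one exponent, so the logarithmic derivative becomes `rβ/(1-βt)
  -- + (r+1)/(1-t)`. Clearing `1-t` leaves a term in `(1-t)G`, which couples the two sequences; `hb`
  -- is the mirror image.
  have ha : (1 - PowerSeries.X) *
      PowerSeries.derivative ℂ ((1 - PowerSeries.C β * PowerSeries.X) * G) =
      PowerSeries.C (r + 1 : ℂ) * ((1 - PowerSeries.C β * PowerSeries.X) * G) +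
      PowerSeries.C (r : ℂ) * (PowerSeries.C β * ((1 - PowerSeries.X) * G)) := by
    rw [Derivation.leibniz]
    simp only [map_sub, Derivation.map_one_eq_zero, Derivation.leibniz, smul_eq_mul,
      PowerSeries.derivative_X, PowerSeries.derivative_C, map_add, map_one] at *
    linear_combination h
  have hb : (1 - PowerSeries.C β * PowerSeries.X) *
      PowerSeries.derivative ℂ ((1 - PowerSeries.X) * G) =
      PowerSeries.C (r : ℂ) * ((1 - PowerSeries.C β * PowerSeries.X) * G) +
      PowerSeries.C (r + 1 : ℂ) * (PowerSeries.C β * ((1 - PowerSeries.X) * G)) := by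
    rw [Derivation.leibniz]
    simp only [map_sub, Derivation.map_one_eq_zero, Derivation.leibniz, smul_eq_mul,
      PowerSeries.derivative_X, PowerSeries.derivative_C, map_add, map_one] at *
    linear_combination h
  have ha' := congrArg (PowerSeries.coeff m) ha
  have hb' := congrArg (PowerSeries.coeff m) hb
  rw [sub_mul, one_mul, map_sub, map_add, PowerSeries.coeff_C_mul, PowerSeries.coeff_C_mul,
    PowerSeries.coeff_C_mul, PowerSeries.coeff_derivative] at ha'
  rw [sub_mul, one_mul, mul_assoc, map_sub, map_add, PowerSeries.coeff_C_mul,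
    PowerSeries.coeff_C_mul, PowerSeries.coeff_C_mul, PowerSeries.coeff_C_mul,
    PowerSeries.coeff_derivative] at hb'
  cases m with
  | zero =>
    rw [PowerSeries.coeff_zero_X_mul] at ha' hb'
    simp only [a, b]
    push_cast at *
    exact ⟨by linear_combination ha', by linear_combination hb'⟩
  | succ m =>
    rw [PowerSeries.coeff_succ_X_mul, PowerSeries.coeff_derivative] at ha' hb'
    simp only [a, b]
    push_cast at *
    exact ⟨by linear_combination ha', by linear_combination hb'⟩

/-- The difference of the two squared norms is `((m+r+1)^2 - r^2)(|A|^2 - |B|^2)`: the cross terms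
agree, and the first factor is `(m+1)(m+2r+1) > 0`. -/
theorem norm_lt_of_norm_lt (m r : ℝ) (hm : 0 ≤ m) (hr : 0 ≤ r) {A B : ℂ} (h : ‖B‖ < ‖A‖) :
    ‖(r : ℂ) * A + (m + r + 1) * B‖ < ‖(m + r + 1 : ℂ) * A + r * B‖ := by
  have h2 : Complex.normSq B < Complex.normSq A := by
    rw [Complex.normSq_eq_norm_sq, Complex.normSq_eq_norm_sq]
    gcongr
  rw [← sq_lt_sq₀ (norm_nonneg _) (norm_nonneg _), ← Complex.normSq_eq_norm_sq,
    ← Complex.normSq_eq_norm_sq]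
  simp only [Complex.normSq_apply, Complex.add_re, Complex.add_im, Complex.mul_re, Complex.mul_im,
    Complex.ofReal_re, Complex.ofReal_im, Complex.one_re, Complex.one_im] at *
  have : 0 < (m + 1) * (m + 2 * r + 1) * ((A.re * A.re + A.im * A.im) - (B.re * B.re + B.im * B.im)) := by
    apply mul_pos (by positivity)
    linarith
  nlinarith [this]

/-- If the coefficient `c_(m+1)` vanishes, then `a_(m+1) = -β c_m` and `b_(m+1) = -c_m`, so
`|a_(m+1)| = |β| |b_(m+1)|`. The recurrence propagates `|b| < |a|` when `|β| < 1` and `|a| < |b|`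
when `|β| > 1`, contradicting this in both cases. -/
theorem coeff_gegenbauerSeries_ne_zero (r : ℕ) {β : ℂ} (hβ : ‖β‖ ≠ 1) (m : ℕ) :
    PowerSeries.coeff m (gegenbauerSeries r β) ≠ 0 := by
  have hrec := gegenbauerSeries_recurrence r β
  set G := gegenbauerSeries r β with hG
  have c0 : PowerSeries.coeff 0 G = 1 := by
    rw [hG, coeff_gegenbauerSeries]; simp
  set a : ℕ → ℂ := fun m => PowerSeries.coeff m ((1 - PowerSeries.C β * PowerSeries.X) * G)
    with ha
  set b : ℕ → ℂ := fun m => PowerSeries.coeff m ((1 - PowerSeries.X) * G) with hb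
  have a0 : a 0 = 1 := by simpa [ha] using c0
  have b0 : b 0 = 1 := by simpa [hb] using c0
  have as : ∀ m, a (m + 1) = PowerSeries.coeff (m + 1) G - β * PowerSeries.coeff m G := by
    intro m
    simp only [ha]
    rw [sub_mul, one_mul, mul_assoc, map_sub, PowerSeries.coeff_C_mul,
      PowerSeries.coeff_succ_X_mul]
  have bs : ∀ m, b (m + 1) = PowerSeries.coeff (m + 1) G - PowerSeries.coeff m G := by
    intro m
    simp only [hb]
    rw [sub_mul, one_mul, map_sub, PowerSeries.coeff_succ_X_mul]
  have na : ∀ m : ℕ, ‖((m : ℂ) + 1) * a (m + 1)‖ = (m + 1) * ‖a (m + 1)‖ := by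
    intro m
    rw [norm_mul]; congr 1
    exact_mod_cast Complex.norm_natCast (m + 1)
  have nb : ∀ m : ℕ, ‖((m : ℂ) + 1) * b (m + 1)‖ = (m + 1) * ‖b (m + 1)‖ := by
    intro m
    rw [norm_mul]; congr 1
    exact_mod_cast Complex.norm_natCast (m + 1)
  cases m with
  | zero => rw [c0]; exact one_ne_zero
  | succ m =>
  intro h0
  have h1 := as m
  have h2 := bs m
  rw [h0, zero_sub] at h1 h2
  have h1' : ‖a (m + 1)‖ = ‖β‖ * ‖PowerSeries.coeff m G‖ := by rw [h1, norm_neg, norm_mul]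
  have h2' : ‖b (m + 1)‖ = ‖PowerSeries.coeff m G‖ := by rw [h2, norm_neg]
  rcases lt_or_gt_of_ne hβ with hlt | hgt
  -- Strictness starts only at index `1`, since `a_0 = b_0 = 1`. The weak inequality with `|a| > 0`
  -- suffices for the first step because multiplying `b` by `β` shrinks it.
  · have main : ∀ m, ‖b m‖ ≤ ‖a m‖ ∧ 0 < ‖a m‖ ∧ (0 < m → ‖b m‖ < ‖a m‖) := by
      intro m
      induction m with
      | zero => simp [a0, b0]
      | succ m ih =>
        have hB : ‖β * b m‖ < ‖a m‖ := by
          rw [norm_mul]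
          rcases eq_or_ne ‖b m‖ 0 with h | h
          · rw [h, mul_zero]; exact ih.2.1
          · have : 0 < ‖b m‖ := lt_of_le_of_ne (norm_nonneg _) (Ne.symm h)
            nlinarith [ih.1]
        have := norm_lt_of_norm_lt m r (by positivity) (by positivity) hB
        push_cast at this
        rw [← (hrec m).1, ← (hrec m).2, na, nb] at this
        have hl := lt_of_mul_lt_mul_left this (by positivity)
        exact ⟨hl.le, (norm_nonneg _).trans_lt hl, fun _ => hl⟩
    have := (main (m + 1)).2.2 (Nat.succ_pos m)
    rw [h1', h2'] at this
    nlinarith [norm_nonneg (PowerSeries.coeff m G)]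
  · have main : ∀ m, ‖a m‖ ≤ ‖b m‖ ∧ 0 < ‖b m‖ ∧ (0 < m → ‖a m‖ < ‖b m‖) := by
      intro m
      induction m with
      | zero => simp [a0, b0]
      | succ m ih =>
        have hB : ‖a m‖ < ‖β * b m‖ := by
          rw [norm_mul]
          nlinarith [ih.1, ih.2.1]
        have := norm_lt_of_norm_lt m r (by positivity) (by positivity) hB
        push_cast at this
        rw [add_comm ((r : ℂ) * _), add_comm (((m : ℂ) + r + 1) * (β * b m)),
          ← (hrec m).1, ← (hrec m).2, na, nb] at this
        have hl := lt_of_mul_lt_mul_left this (by positivity)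
        exact ⟨hl.le, (norm_nonneg _).trans_lt hl, fun _ => hl⟩
    have := (main (m + 1)).2.2 (Nat.succ_pos m)
    rw [h1', h2'] at this
    nlinarith [norm_nonneg (PowerSeries.coeff m G)]

/-- Here the series is `(1-t^2)^(-(r+1))`. Adding the two recurrences at `β = -1` gives `(M+1)
c_(M+1) = (M+2r+1) c_(M-1)`, used with `M = 2m+1`. -/
theorem coeff_two_mul_gegenbauerSeries_ne_zero (r m : ℕ) :
    PowerSeries.coeff (2 * m) (gegenbauerSeries r (-1)) ≠ 0 := by
  induction m with
  | zero => rw [coeff_gegenbauerSeries]; simp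
  | succ m ih =>
    have h := gegenbauerSeries_recurrence r (-1) (2 * m + 1)
    simp only [sub_mul, one_mul, mul_assoc, map_sub, PowerSeries.coeff_C_mul,
      PowerSeries.coeff_succ_X_mul] at h
    obtain ⟨h1, h2⟩ := h
    push_cast at h1 h2
    intro h0
    rw [show 2 * (m + 1) = 2 * m + 1 + 1 from rfl] at h0
    rw [h0] at h1 h2
    have : ((2 * m + 1 + 2 * r + 1 : ℕ) : ℂ) * PowerSeries.coeff (2 * m) (gegenbauerSeries r (-1)) = 0 := by
      push_cast
      linear_combination (-1 / 2 : ℂ) * h1 - (1 / 2 : ℂ) * h2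
    rcases mul_eq_zero.mp this with h | h
    · exact (Nat.cast_ne_zero.mpr (by omega)) h
    · exact ih h

/-! ### Generalities on the enveloping algebra -/

/-- The image of the matrix unit `E_{ij}` in `U(gl_2)`. -/
abbrev eU (i j : Fin 2) : Ugl 2 :=
  UniversalEnvelopingAlgebra.ι ℂ (Matrix.single i j (1 : ℂ) : Gl 2)

/-- The elements whose left multiplication preserves `C` form a subalgebra `S` containing `gl_n`.
The universal property maps the enveloping algebra into `S`, and composing with the inclusion gives
the identity, so `S` is everything; apply it to `1`. -/
theorem ugl_left_induction {n : ℕ} {C : Ugl n → Prop} (one : C 1)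
    (add : ∀ u v, C u → C v → C (u + v)) (smul : ∀ (c : ℂ) u, C u → C (c • u))
    (ι_mul : ∀ (x : Gl n) u, C u → C (UniversalEnvelopingAlgebra.ι ℂ x * u)) (u : Ugl n) : C u := by
  let S : Subalgebra ℂ (Ugl n) :=
    { carrier := {a | ∀ u, C u → C (a * u)}
      mul_mem' := fun {a b} ha hb u hu => by rw [mul_assoc]; exact ha _ (hb _ hu)
      add_mem' := fun {a b} ha hb u hu => by rw [add_mul]; exact add _ _ (ha _ hu) (hb _ hu)
      algebraMap_mem' := fun r u hu => by
        rw [Algebra.algebraMap_eq_smul_one, smul_mul_assoc, one_mul]; exact smul _ _ hu }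
  let g : Gl n →ₗ⁅ℂ⁆ S :=
    { toFun := fun x => ⟨UniversalEnvelopingAlgebra.ι ℂ x, fun u hu => ι_mul x u hu⟩
      map_add' := fun x y => Subtype.ext (map_add _ x y)
      map_smul' := fun c x => Subtype.ext (map_smul _ c x)
      map_lie' := fun {x y} => Subtype.ext
        (LieHom.map_lie (UniversalEnvelopingAlgebra.ι ℂ) x y) }
  have h : S.val.comp (UniversalEnvelopingAlgebra.lift ℂ g) = AlgHom.id ℂ _ := by
    apply UniversalEnvelopingAlgebra.hom_ext
    ext x
    change ((UniversalEnvelopingAlgebra.lift ℂ g (UniversalEnvelopingAlgebra.ι ℂ x) : S) : Ugl n) = _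
    rw [UniversalEnvelopingAlgebra.lift_ι_apply]
    rfl
  have h2 : ((UniversalEnvelopingAlgebra.lift ℂ g u : S) : Ugl n) = u :=
    congrArg (fun f => f u) h
  have h3 := (UniversalEnvelopingAlgebra.lift ℂ g u).2 1 one
  rw [mul_one, h2] at h3
  exact h3

section

variable {n : ℕ} {M N : Type} [AddCommGroup M] [Module ℂ M] [LieRingModule (Gl n) M]
  [LieModule ℂ (Gl n) M] [AddCommGroup N] [Module ℂ N] [LieRingModule (Gl n) N]
  [LieModule ℂ (Gl n) N]

@[simp]
theorem uAct_ι (x : Gl n) (m : M) : uAct n M (UniversalEnvelopingAlgebra.ι ℂ x) m = ⁅x, m⁆ := by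
  rw [uAct, UniversalEnvelopingAlgebra.lift_ι_apply]; rfl

theorem map_uAct (f : M →ₗ⁅ℂ, Gl n⁆ N) (u : Ugl n) (m : M) :
    f (uAct n M u m) = uAct n N u (f m) := by
  induction u using ugl_left_induction with
  | one => simp
  | add u v hu hv => simp [hu, hv]
  | smul c u hu => simp [hu]
  | ι_mul x u hu => rw [map_mul, map_mul, Module.End.mul_apply, Module.End.mul_apply, uAct_ι,
      uAct_ι, LieModuleHom.map_lie, hu]

theorem UIso.of_lieModuleEquiv (e : M ≃ₗ⁅ℂ, Gl n⁆ N) : UIso n M N :=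
  ⟨e.toLinearEquiv, fun u m => map_uAct e.toLieModuleHom u m⟩

theorem UIso.symm (h : UIso n M N) : UIso n N M := by
  obtain ⟨e, he⟩ := h
  refine ⟨e.symm, fun u m => ?_⟩
  apply e.injective
  rw [he, e.apply_symm_apply, e.apply_symm_apply]

theorem UIso.trans {P : Type} [AddCommGroup P] [Module ℂ P] [LieRingModule (Gl n) P]
    [LieModule ℂ (Gl n) P] (h : UIso n M N) (h' : UIso n N P) : UIso n M P := by
  obtain ⟨e, he⟩ := h
  obtain ⟨f, hf⟩ := h'
  exact ⟨e.trans f, fun u m => by simp [he, hf]⟩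

theorem mem_cyclic {m x : M} : x ∈ cyclic n m ↔ ∃ u, uAct n M u m = x := Iff.rfl

theorem self_mem_cyclic (m : M) : m ∈ cyclic n m := ⟨1, by simp⟩

theorem uAct_mem {W : LieSubmodule ℂ (Gl n) M} {m : M} (hm : m ∈ W) (u : Ugl n) :
    uAct n M u m ∈ W := by
  induction u using ugl_left_induction with
  | one => simpa
  | add u v hu hv => simpa using add_mem hu hv
  | smul c u hu => simpa using W.smul_mem c hu
  | ι_mul x u hu => rw [map_mul, Module.End.mul_apply, uAct_ι]; exact W.lie_mem hu

theorem cyclic_le {W : LieSubmodule ℂ (Gl n) M} {m : M} : cyclic n m ≤ W ↔ m ∈ W := by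
  refine ⟨fun h => h (self_mem_cyclic m), ?_⟩
  rintro hm _ ⟨u, rfl⟩
  exact uAct_mem hm u

end

/-- If a sum of eigenvectors with distinct eigenvalues lies in a stable subspace, then so does
every summand. -/
theorem mem_of_sum_eigenvectors_mem {M ι : Type*} [AddCommGroup M] [Module ℂ M]
    (f : Module.End ℂ M) (p : Submodule ℂ M) (hp : ∀ x ∈ p, f x ∈ p) (μ : ι → ℂ)
    (x : ι → M) (s : Finset ι) (hμ : Set.InjOn μ s) (hx : ∀ i ∈ s, f (x i) = μ i • x i)
    (hs : ∑ i ∈ s, x i ∈ p) : ∀ i ∈ s, x i ∈ p := by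
  classical
  induction s using Finset.induction_on generalizing x with
  | empty => simp
  | insert j s hj ih =>
    -- Applying `f - μ j` kills the `j`-th summand and only rescales the others by nonzero factors.
    have h1 : ∑ i ∈ s, (μ i - μ j) • x i ∈ p := by
      have : ∑ i ∈ s, (μ i - μ j) • x i = f (∑ i ∈ insert j s, x i) -
          μ j • ∑ i ∈ insert j s, x i := by
        rw [map_sum, Finset.smul_sum, ← Finset.sum_sub_distrib, Finset.sum_insert hj,
          hx j (Finset.mem_insert_self _ _), sub_self, zero_add]
        exact Finset.sum_congr rfl fun i hi => by
          rw [hx i (Finset.mem_insert_of_mem hi), sub_smul]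
      rw [this]
      exact sub_mem (hp _ hs) (p.smul_mem _ hs)
    have h2 : ∀ i ∈ s, x i ∈ p := by
      intro i hi
      have h3 := ih (fun i => (μ i - μ j) • x i)
        (hμ.mono (by simp)) (fun i hi => by
          rw [map_smul, hx i (Finset.mem_insert_of_mem hi), smul_comm]) h1 i hi
      have hne : μ i - μ j ≠ 0 := by
        rw [sub_ne_zero]
        intro h
        have := hμ (by simp [hi]) (by simp) h
        exact hj (this ▸ hi)
      simpa [smul_smul, inv_mul_cancel₀ hne] using p.smul_mem (μ i - μ j)⁻¹ h3
    intro i hi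
    rcases Finset.mem_insert.mp hi with rfl | hi
    · rw [Finset.sum_insert hj] at hs
      simpa using sub_mem hs (p.sum_mem h2)
    · exact h2 i hi

/-! ### Highest weight vectors -/

theorem eU_comm (i j k l : Fin 2) : eU i j * eU k l = eU k l * eU i j +
    ((if j = k then eU i l else 0) - (if l = i then eU k j else 0)) := by
  have h := (UniversalEnvelopingAlgebra.ι ℂ).map_lie (Matrix.single i j (1 : ℂ) : Gl 2)
    (Matrix.single k l (1 : ℂ) : Gl 2)
  rw [LieRing.of_associative_ring_bracket, LieRing.of_associative_ring_bracket, map_sub] at h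
  rw [← sub_eq_iff_eq_add', ← h]
  congr 1
  · split_ifs with hjk
    · subst hjk; simp
    · rw [Matrix.single_mul_single_of_ne _ _ _ _ hjk]; simp
  · split_ifs with hjk
    · subst hjk; simp
    · rw [Matrix.single_mul_single_of_ne _ _ _ _ hjk]; simp

theorem ι_eq_sum (x : Gl 2) : UniversalEnvelopingAlgebra.ι ℂ x =
    x 0 0 • eU 0 0 + x 0 1 • eU 0 1 + x 1 0 • eU 1 0 + x 1 1 • eU 1 1 := by
  conv_lhs => rw [Matrix.matrix_eq_sum_single x]
  simp only [Fin.sum_univ_two, map_add]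
  have : ∀ i j (c : ℂ), (Matrix.single i j c : Gl 2) = c • Matrix.single i j (1 : ℂ) := by
    intro i j c; simp
  rw [this 0 0, this 0 1, this 1 0, this 1 1]
  simp only [map_smul]
  abel

/-- The vector `q` is killed by `E_{12}` and has weight `(a, b)`. -/
structure IsHighest {Q : Type} [AddCommGroup Q] [Module ℂ Q] (ρ : Ugl 2 →ₐ[ℂ] Module.End ℂ Q)
    (a b : ℂ) (q : Q) : Prop where
  he : ρ (eU 0 1) q = 0
  ha : ρ (eU 0 0) q = a • q
  hd : ρ (eU 1 1) q = b • q

section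

variable {Q : Type} [AddCommGroup Q] [Module ℂ Q] {ρ : Ugl 2 →ₐ[ℂ] Module.End ℂ Q}
  {a b : ℂ} {q : Q}

theorem comm_apply (ρ : Ugl 2 →ₐ[ℂ] Module.End ℂ Q) {u v w : Ugl 2} (h : u * v = v * u + w)
    (q : Q) : ρ u (ρ v q) = ρ v (ρ u q) + ρ w q := by
  have := congrArg (fun z => ρ z q) h
  simpa using this

theorem ρ_F_pow_succ (ρ : Ugl 2 →ₐ[ℂ] Module.End ℂ Q) (k : ℕ) (q : Q) :
    ρ (eU 1 0 ^ (k + 1)) q = ρ (eU 1 0) (ρ (eU 1 0 ^ k) q) := by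
  rw [pow_succ', map_mul]; rfl

namespace IsHighest

theorem a_F (h : IsHighest ρ a b q) (k : ℕ) :
    ρ (eU 0 0) (ρ (eU 1 0 ^ k) q) = (a - k) • ρ (eU 1 0 ^ k) q := by
  induction k with
  | zero => simpa [-UniversalEnvelopingAlgebra.ι_apply] using h.ha
  | succ k ih =>
    have := comm_apply ρ (eU_comm 0 0 1 0) (ρ (eU 1 0 ^ k) q)
    rw [← ρ_F_pow_succ, ih] at this
    rw [this]
    simp only [map_smul, ← ρ_F_pow_succ]
    simp only [Fin.isValue, zero_ne_one, if_true, if_false, zero_sub, map_neg,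
      LinearMap.neg_apply, ← ρ_F_pow_succ]
    push_cast
    module

theorem d_F (h : IsHighest ρ a b q) (k : ℕ) :
    ρ (eU 1 1) (ρ (eU 1 0 ^ k) q) = (b + k) • ρ (eU 1 0 ^ k) q := by
  induction k with
  | zero => simpa [-UniversalEnvelopingAlgebra.ι_apply] using h.hd
  | succ k ih =>
    have := comm_apply ρ (eU_comm 1 1 1 0) (ρ (eU 1 0 ^ k) q)
    rw [← ρ_F_pow_succ, ih] at this
    rw [this]
    simp only [map_smul, ← ρ_F_pow_succ]
    simp only [Fin.isValue, zero_ne_one, if_true, if_false, sub_zero,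
      ← ρ_F_pow_succ]
    push_cast
    module

/-- The `sl_2` relation: each commutation of `E_12` past `E_21` contributes the current weight
difference `a - b - 2i`, and these sum over `i ≤ k` to `(k+1)(a-b-k)`. -/
theorem e_F (h : IsHighest ρ a b q) (k : ℕ) :
    ρ (eU 0 1) (ρ (eU 1 0 ^ (k + 1)) q) = ((k + 1) * (a - b - k)) • ρ (eU 1 0 ^ k) q := by
  induction k with
  | zero =>
    have := comm_apply ρ (eU_comm 0 1 1 0) q
    rw [h.he] at this
    simp only [Fin.isValue, if_true, map_sub, LinearMap.sub_apply, h.ha, h.hd] at this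
    simp only [zero_add, pow_one, this]
    simp
    module
  | succ k ih =>
    have := comm_apply ρ (eU_comm 0 1 1 0) (ρ (eU 1 0 ^ (k + 1)) q)
    rw [← ρ_F_pow_succ, ih] at this
    simp only [Fin.isValue, if_true, map_sub, LinearMap.sub_apply, h.a_F, h.d_F, map_smul,
      ← ρ_F_pow_succ] at this
    rw [this]
    push_cast
    module

/-- The span of the vectors `F^k q` is stable under all four matrix units, hence under the whole
enveloping algebra. -/
theorem orbit (h : IsHighest ρ a b q) (u : Ugl 2) :
    ∃ (m : ℕ) (c : ℕ → ℂ), ρ u q = ∑ k ∈ Finset.range m, c k • ρ (eU 1 0 ^ k) q := by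
  have key : ∀ u, ρ u q ∈ Submodule.span ℂ (Set.range fun k : ℕ => ρ (eU 1 0 ^ k) q) := by
    intro u
    induction u using ugl_left_induction with
    | one => exact Submodule.subset_span ⟨0, by simp⟩
    | add u v hu hv => simpa using add_mem hu hv
    | smul c u hu => simpa using Submodule.smul_mem _ c hu
    | ι_mul x u hu =>
      rw [map_mul, Module.End.mul_apply]
      generalize ρ u q = z at hu
      induction hu using Submodule.span_induction with
      | zero => simp
      | add x y _ _ hx hy => rw [map_add]; exact add_mem hx hy
      | smul c x _ hx => rw [map_smul]; exact Submodule.smul_mem _ c hx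
      | mem y hy =>
        obtain ⟨k, rfl⟩ := hy
        have hm : ∀ k : ℕ, ρ (eU 1 0 ^ k) q ∈
            Submodule.span ℂ (Set.range fun k : ℕ => ρ (eU 1 0 ^ k) q) :=
          fun k => Submodule.subset_span ⟨k, rfl⟩
        rw [ι_eq_sum]
        simp only [map_add, map_smul, LinearMap.add_apply, LinearMap.smul_apply, h.a_F,
          h.d_F, ← ρ_F_pow_succ]
        refine add_mem (add_mem (add_mem ?_ ?_) ?_) ?_ <;> refine Submodule.smul_mem _ _ ?_
        · exact Submodule.smul_mem _ _ (hm k)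
        · cases k with
          | zero => rw [pow_zero, map_one, Module.End.one_apply, h.he]; exact Submodule.zero_mem _
          | succ k => rw [h.e_F]; exact Submodule.smul_mem _ _ (hm k)
        · exact hm _
        · exact Submodule.smul_mem _ _ (hm k)
  obtain ⟨c, hc⟩ := (Finsupp.mem_span_range_iff_exists_finsupp).mp (key u)
  obtain ⟨m, hm⟩ := c.support.exists_nat_subset_range
  refine ⟨m, c, ?_⟩
  rw [← hc]
  exact Finsupp.sum_of_support_subset _ hm _ (by simp)

theorem e_pow_F_pow (h : IsHighest ρ a b q) {n : ℕ} (hn : a - b = n) {k : ℕ} (hk : k ≤ n) :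
    ∃ c : ℂ, c ≠ 0 ∧ ρ (eU 0 1 ^ k) (ρ (eU 1 0 ^ k) q) = c • q := by
  induction k with
  | zero => exact ⟨1, one_ne_zero, by simp⟩
  | succ k ih =>
    obtain ⟨c, hc, e⟩ := ih (by omega)
    refine ⟨((k + 1) * (a - b - k)) * c, mul_ne_zero (mul_ne_zero ?_ ?_) hc, ?_⟩
    · exact Nat.cast_add_one_ne_zero k
    · rw [hn, sub_ne_zero]; exact_mod_cast (by omega : n ≠ k)
    · rw [pow_succ (eU 0 1), map_mul, Module.End.mul_apply, h.e_F, map_smul, e, smul_smul]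

theorem F_pow_ne_zero (h : IsHighest ρ a b q) (hq : q ≠ 0) {n : ℕ} (hn : a - b = n) {k : ℕ}
    (hk : k ≤ n) : ρ (eU 1 0 ^ k) q ≠ 0 := by
  intro h0
  obtain ⟨c, hc, e⟩ := h.e_pow_F_pow hn hk
  rw [h0, map_zero] at e
  exact smul_ne_zero hc hq e.symm

theorem F_pow_eq_zero_of_lt {n : ℕ} (h0 : ρ (eU 1 0 ^ (n + 1)) q = 0) {k : ℕ} (hk : n < k) :
    ρ (eU 1 0 ^ k) q = 0 := by
  obtain ⟨j, rfl⟩ := Nat.exists_eq_add_of_lt hk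
  rw [show n + j + 1 = j + (n + 1) by ring, pow_add, map_mul, Module.End.mul_apply, h0, map_zero]

/-- In a finite-dimensional module the highest weight vector is killed by `F^{n+1}`. -/
theorem F_pow_eq_zero [FiniteDimensional ℂ Q] (h : IsHighest ρ a b q) {n : ℕ} (hn : a - b = n) :
    ρ (eU 1 0 ^ (n + 1)) q = 0 := by
  by_contra h0
  -- The factor `(k+1)(n-k)` in `e_F` vanishes only at `k = n`, so once `F^(n+1) q` survives, every
  -- later power does. This yields infinitely many independent weight vectors.
  have key : ∀ k, ρ (eU 1 0 ^ k) q ≠ 0 := by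
    intro k
    rcases le_or_gt k n with hk | hk
    · intro hz
      apply h0
      rw [show n + 1 = (n + 1 - k) + k by omega, pow_add, map_mul, Module.End.mul_apply, hz,
        map_zero]
    · induction k, hk using Nat.le_induction with
      | base => exact h0
      | succ k hk ih =>
        intro hz
        have := h.e_F k
        rw [hz, map_zero] at this
        refine smul_ne_zero (mul_ne_zero (Nat.cast_add_one_ne_zero k) ?_) ih this.symm
        rw [hn, sub_ne_zero]
        exact_mod_cast (by omega : n ≠ k)
  have hli := Module.End.eigenvectors_linearIndependent' (ρ (eU 0 0)) (fun k : ℕ => a - (k : ℂ))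
    (fun i j hij => by simpa using hij) (fun k => ρ (eU 1 0 ^ k) q)
    (fun k => ⟨Module.End.mem_eigenspace_iff.mpr (h.a_F k), key k⟩)
  exact not_finite_iff_infinite.mpr inferInstance hli.finite

end IsHighest

end

/-! ### The irreducible highest weight module as a cyclic submodule -/

theorem lsmul_mk_one (N : Submodule (Ugl 2) (Ugl 2)) (u : Ugl 2) :
    Algebra.lsmul ℂ ℂ (Ugl 2 ⧸ N) u (Submodule.Quotient.mk 1) = Submodule.Quotient.mk u := by
  change Submodule.Quotient.mk (u • 1) = _
  rw [smul_eq_mul, mul_one]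

theorem isHighest_quotient {a b : ℂ} {N : Submodule (Ugl 2) (Ugl 2)}
    (hN : vermaIdeal 2 ![a, b] ≤ N) :
    IsHighest (Algebra.lsmul ℂ ℂ (Ugl 2 ⧸ N)) a b (Submodule.Quotient.mk (1 : Ugl 2)) := by
  have hdiag : ∀ i : Fin 2, Algebra.lsmul ℂ ℂ (Ugl 2 ⧸ N) (eU i i) (Submodule.Quotient.mk 1) =
      (![a, b] i) • (Submodule.Quotient.mk (1 : Ugl 2) : Ugl 2 ⧸ N) := by
    intro i
    rw [lsmul_mk_one, ← Submodule.Quotient.mk_smul,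
      Submodule.Quotient.eq]
    apply hN
    refine Submodule.subset_span (Or.inr ⟨i, ?_⟩)
    rw [Algebra.algebraMap_eq_smul_one]
  refine ⟨?_, hdiag 0, hdiag 1⟩
  rw [lsmul_mk_one, Submodule.Quotient.mk_eq_zero]
  apply hN
  exact Submodule.subset_span (Or.inl ⟨0, 1, by decide, rfl⟩)

/-- The annihilator `K` of `v` is a proper left ideal above the Verma ideal, so it lies in the
maximal one. Conversely, let `N` be any proper left ideal above the Verma ideal. Modulo that ideal
an element of `N` is `∑ c_k F^k`; since `F^k · 1 ≠ 0` in the quotient by `N` for `k ≤ n`, weights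
force `c_k = 0` there, while `F^k` kills `v` for `k > n`. -/
theorem IsHighest.mem_maxIdeal {M : Type} [AddCommGroup M] [Module ℂ M]
    {ρ : Ugl 2 →ₐ[ℂ] Module.End ℂ M} {a b : ℂ} {v : M} (h : IsHighest ρ a b v) (hv : v ≠ 0)
    {n : ℕ} (hn : a - b = n) (hF : ρ (eU 1 0 ^ (n + 1)) v = 0) (u : Ugl 2) :
    u ∈ maxIdeal 2 ![a, b] ↔ ρ u v = 0 := by
  let K : Submodule (Ugl 2) (Ugl 2) :=
    { carrier := {u | ρ u v = 0}
      add_mem' := fun {x y} hx hy => by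
        simp only [Set.mem_ofPred_eq] at *
        simp [hx, hy]
      zero_mem' := by simp
      smul_mem' := fun c x hx => by
        simp only [Set.mem_ofPred_eq] at *
        simp [hx] }
  have hvK : vermaIdeal 2 ![a, b] ≤ K := by
    refine Submodule.span_le.mpr ?_
    rintro _ (⟨i, j, hij, rfl⟩ | ⟨i, rfl⟩)
    · obtain ⟨rfl, rfl⟩ : i = 0 ∧ j = 1 := by omega
      exact h.he
    · change ρ _ v = 0
      rw [map_sub, AlgHom.commutes, LinearMap.sub_apply, Module.algebraMap_end_apply, sub_eq_zero]
      fin_cases i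
      · exact h.ha
      · exact h.hd
  constructor
  · intro hu
    suffices maxIdeal 2 ![a, b] ≤ K from this hu
    refine sSup_le ?_
    rintro N ⟨hvN, hN⟩ u hu
    obtain ⟨m, c, hc⟩ := (isHighest_quotient (le_refl (vermaIdeal 2 ![a, b]))).orbit u
    set g : Ugl 2 := ∑ k ∈ Finset.range m, c k • eU 1 0 ^ k with hg
    have hug : u - g ∈ vermaIdeal 2 ![a, b] := by
      simp only [lsmul_mk_one, ← Submodule.Quotient.mk_smul] at hc
      rw [← Submodule.Quotient.eq, hc, hg]
      exact (map_sum (Submodule.mkQ _) _ _).symm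
    have hgN : g ∈ N := by
      have := sub_mem hu (hvN hug)
      simpa using this
    have h1 := isHighest_quotient hvN
    have hq : (Submodule.Quotient.mk (1 : Ugl 2) : Ugl 2 ⧸ N) ≠ 0 := by
      rw [Ne, Submodule.Quotient.mk_eq_zero]
      exact fun h1 => hN ((Ideal.eq_top_iff_one N).mpr h1)
    -- With the zero subspace as target, this says that a vanishing sum of vectors of distinct
    -- weights vanishes term by term.
    have hz := mem_of_sum_eigenvectors_mem (Algebra.lsmul ℂ ℂ (Ugl 2 ⧸ N) (eU 0 0)) ⊥
      (by simp) (fun k : ℕ => a - k)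
      (fun k => c k • Algebra.lsmul ℂ ℂ (Ugl 2 ⧸ N) (eU 1 0 ^ k) (Submodule.Quotient.mk 1))
      (Finset.range m) (fun i _ j _ hij => by simpa using hij)
      (fun k _ => by rw [map_smul, h1.a_F, smul_comm])
      (by
        simp only [lsmul_mk_one, ← Submodule.Quotient.mk_smul]
        rw [Submodule.mem_bot, ← (Submodule.Quotient.mk_eq_zero N).mpr hgN, hg]
        exact (map_sum (Submodule.mkQ _) _ _).symm)
    change ρ u v = 0
    have hu' : ρ u v = ρ g v := by
      have : ρ (u - g) v = 0 := hvK hug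
      rwa [map_sub, LinearMap.sub_apply, sub_eq_zero] at this
    rw [hu', hg, map_sum, LinearMap.sum_apply]
    refine Finset.sum_eq_zero fun k hk => ?_
    rw [map_smul, LinearMap.smul_apply]
    rcases le_or_gt k n with hkn | hkn
    · have := hz k hk
      rw [Submodule.mem_bot] at this
      rcases smul_eq_zero.mp this with h0 | h0
      · rw [h0, zero_smul]
      · exact absurd h0 (h1.F_pow_ne_zero hq hn hkn)
    · rw [IsHighest.F_pow_eq_zero_of_lt hF hkn, smul_zero]
  · intro hu
    have : K ≤ maxIdeal 2 ![a, b] := le_sSup ⟨hvK, fun htop => hv (by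
      have : (1 : Ugl 2) ∈ K := htop ▸ Submodule.mem_top
      simpa [K] using this)⟩
    exact this hu

section

variable {M : Type} [AddCommGroup M] [Module ℂ M] [LieRingModule (Gl 2) M] [LieModule ℂ (Gl 2) M]

/-- The vector `v` is a nonzero highest weight vector of weight `(a, b)`, with `a - b = n ∈ ℕ`,
generating a finite-dimensional module. -/
structure IsDominant (a b : ℂ) (n : ℕ) (v : M) : Prop extends IsHighest (uAct 2 M) a b v where
  ne_zero : v ≠ 0
  sub_eq : a - b = n
  f_pow : uAct 2 M (eU 1 0 ^ (n + 1)) v = 0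

namespace IsDominant

variable {a b : ℂ} {n : ℕ} {v : M}

theorem exists_hwEquiv (h : IsDominant a b n v) :
    Nonempty (HW 2 ![a, b] ≃ₗ⁅ℂ, Gl 2⁆ cyclic 2 v) := by
  let o : Ugl 2 →ₗ[ℂ] M := (LinearMap.applyₗ v).comp (uAct 2 M).toLinearMap
  have hker : (maxIdeal 2 ![a, b]).restrictScalars ℂ = LinearMap.ker o := by
    ext u
    rw [Submodule.restrictScalars_mem, h.toIsHighest.mem_maxIdeal h.ne_zero h.sub_eq h.f_pow]
    rfl
  let e : HW 2 ![a, b] ≃ₗ[ℂ] LinearMap.range o :=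
    ((Submodule.Quotient.restrictScalarsEquiv ℂ (maxIdeal 2 ![a, b])).symm.trans
      (Submodule.quotEquivOfEq _ _ hker)).trans o.quotKerEquivRange
  refine ⟨{ e with map_lie' := ?_ }⟩
  intro x m
  obtain ⟨u, rfl⟩ := Submodule.Quotient.mk_surjective _ m
  apply Subtype.ext
  change uAct 2 M (UniversalEnvelopingAlgebra.ι ℂ x * u) v = ⁅x, uAct 2 M u v⁆
  rw [map_mul, Module.End.mul_apply, uAct_ι]

theorem linearIndependent (h : IsDominant a b n v) :
    LinearIndependent ℂ fun k : Fin (n + 1) => uAct 2 M (eU 1 0 ^ (k : ℕ)) v :=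
  Module.End.eigenvectors_linearIndependent' (uAct 2 M (eU 0 0))
    (fun k : Fin (n + 1) => a - (k : ℕ)) (fun i j hij => by simpa [Fin.ext_iff] using hij)
    (fun k : Fin (n + 1) => uAct 2 M (eU 1 0 ^ (k : ℕ)) v)
    (fun k => ⟨Module.End.mem_eigenspace_iff.mpr (h.a_F k),
      h.F_pow_ne_zero h.ne_zero h.sub_eq (by omega)⟩)

theorem exists_sum (h : IsDominant a b n v) {w : M} (hw : w ∈ cyclic 2 v) :
    ∃ c : ℕ → ℂ, w = ∑ k ∈ Finset.range (n + 1), c k • uAct 2 M (eU 1 0 ^ k) v := by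
  obtain ⟨u, rfl⟩ := mem_cyclic.mp hw
  obtain ⟨m, c, hc⟩ := h.orbit u
  refine ⟨fun k => if k < m then c k else 0, ?_⟩
  rw [hc]
  have h1 : ∀ N, m ≤ N → ∑ k ∈ Finset.range m, c k • uAct 2 M (eU 1 0 ^ k) v =
      ∑ k ∈ Finset.range N, (if k < m then c k else 0) • uAct 2 M (eU 1 0 ^ k) v := by
    intro N hN
    rw [← Finset.sum_subset (Finset.range_mono hN)]
    · exact Finset.sum_congr rfl fun k hk => by rw [if_pos (Finset.mem_range.mp hk)]
    · intro k _ hk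
      rw [if_neg (by simpa using hk), zero_smul]
  -- Both ranges are padded to a common length; the terms beyond `n` vanish because `F^(n+1) v = 0`.
  rw [h1 (max m (n + 1)) (le_max_left _ _)]
  refine (Finset.sum_subset (Finset.range_mono (le_max_right _ _)) fun k _ hk => ?_).symm
  rw [IsHighest.F_pow_eq_zero_of_lt h.f_pow (by simp at hk; omega), smul_zero]

theorem cyclic_eq_span (h : IsDominant a b n v) : (cyclic 2 v).toSubmodule =
    Submodule.span ℂ (Set.range fun k : Fin (n + 1) => uAct 2 M (eU 1 0 ^ (k : ℕ)) v) := by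
  apply le_antisymm
  · intro w hw
    obtain ⟨c, rfl⟩ := h.exists_sum hw
    refine Submodule.sum_mem _ fun k hk => Submodule.smul_mem _ _ (Submodule.subset_span ?_)
    exact ⟨⟨k, Finset.mem_range.mp hk⟩, rfl⟩
  · refine Submodule.span_le.mpr ?_
    rintro _ ⟨k, rfl⟩
    exact ⟨_, rfl⟩

theorem finite (h : IsDominant a b n v) : FiniteDimensional ℂ (cyclic 2 v) := by
  change FiniteDimensional ℂ (cyclic 2 v).toSubmodule
  rw [h.cyclic_eq_span]
  exact FiniteDimensional.span_of_finite ℂ (Set.finite_range _)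

theorem finrank (h : IsDominant a b n v) : Module.finrank ℂ (cyclic 2 v) = n + 1 := by
  change Module.finrank ℂ (cyclic 2 v).toSubmodule = n + 1
  rw [h.cyclic_eq_span, finrank_span_eq_card h.linearIndependent, Fintype.card_fin]

/-- A submodule containing a nonzero element of the irreducible module generated by `v`
contains `v`. -/
theorem mem_of_mem (h : IsDominant a b n v) {w : M} (hw : w ∈ cyclic 2 v) (hw0 : w ≠ 0)
    {C : LieSubmodule ℂ (Gl 2) M} (hC : w ∈ C) : v ∈ C := by
  obtain ⟨c, rfl⟩ := h.exists_sum hw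
  -- Weights isolate a single nonzero term `c k • F^k v` inside `C`; then `E_12^k` brings it back to
  -- a nonzero multiple of `v`.
  have key := mem_of_sum_eigenvectors_mem (uAct 2 M (eU 0 0)) C.toSubmodule
    (fun x hx => uAct_mem hx _) (fun k : ℕ => a - k) _ (Finset.range (n + 1))
    (fun i _ j _ hij => by simpa using hij) (fun k _ => by rw [map_smul, h.a_F, smul_comm]) hC
  obtain ⟨k, hk, hk0⟩ := Finset.exists_ne_zero_of_sum_ne_zero hw0
  have h1 : uAct 2 M (eU 1 0 ^ k) v ∈ C := by
    have := C.smul_mem (c k)⁻¹ (key k hk)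
    rwa [inv_smul_smul₀ (left_ne_zero_of_smul hk0)] at this
  obtain ⟨d, hd, he⟩ := h.e_pow_F_pow h.sub_eq (k := k) (by simp at hk; omega)
  have h2 := C.smul_mem d⁻¹ (uAct_mem h1 (eU 0 1 ^ k))
  rwa [he, inv_smul_smul₀ hd] at h2

end IsDominant

end

/-! ### The Casimir element -/

/-- The Casimir element `∑ E_{ij} E_{ji}`. -/
def casimir : Ugl 2 :=
  eU 0 0 * eU 0 0 + eU 1 1 * eU 1 1 + eU 0 1 * eU 1 0 + eU 1 0 * eU 0 1

theorem casimir_mul_eU (i j : Fin 2) : casimir * eU i j = eU i j * casimir := by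
  have h0 := fun k => eU_comm k k 0 1
  have h1 := fun k => eU_comm k k 1 0
  have h2 := eU_comm 0 1 1 0
  have h3 := eU_comm 0 0 1 1
  have a1 := h0 0
  have a2 := h0 1
  have a3 := h1 0
  have a4 := h1 1
  clear h0 h1
  simp only [Fin.isValue, zero_ne_one, one_ne_zero, if_true, if_false, sub_zero, zero_sub, add_zero] at *
  unfold casimir
  fin_cases i <;> fin_cases j <;>
    simp only [Fin.isValue, Fin.zero_eta, Fin.mk_one] <;>
    generalize eU 0 0 = A at * <;> generalize eU 1 1 = D at * <;>
    generalize eU 0 1 = E at * <;> generalize eU 1 0 = F at *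
  -- In each case the coefficients are the Leibniz expansion of the commutator of the Casimir
  -- element with the given matrix unit.
  · linear_combination (norm := noncomm_ring) -D * h3 - h3 * D - a1 * F - E * a3 - a3 * E - F * a1
  · linear_combination (norm := noncomm_ring)
      A * a1 + a1 * A + D * a2 + a2 * D - E * h2 - h2 * E
  · linear_combination (norm := noncomm_ring)
      A * a3 + a3 * A + D * a4 + a4 * D + F * h2 + h2 * F
  · linear_combination (norm := noncomm_ring) A * h3 + h3 * A - a2 * F - E * a4 - a4 * E - F * a2

theorem casimir_mul (u : Ugl 2) : casimir * u = u * casimir := by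
  induction u using ugl_left_induction with
  | one => simp
  | add u v hu hv => rw [mul_add, add_mul, hu, hv]
  | smul c u hu => rw [mul_smul_comm, smul_mul_assoc, hu]
  | ι_mul x u hu =>
    rw [← mul_assoc, ι_eq_sum]
    simp only [mul_add, add_mul, mul_smul_comm, smul_mul_assoc, casimir_mul_eU]
    simp only [mul_assoc, hu]

theorem IsHighest.casimir_apply {Q : Type} [AddCommGroup Q] [Module ℂ Q]
    {ρ : Ugl 2 →ₐ[ℂ] Module.End ℂ Q} {a b : ℂ} {q : Q} (h : IsHighest ρ a b q) (u : Ugl 2) :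
    ρ casimir (ρ u q) = (a * a + b * b + (a - b)) • ρ u q := by
  have hq : ρ casimir q = (a * a + b * b + (a - b)) • q := by
    have h2 := h.e_F 0
    simp only [zero_add, pow_one, pow_zero, map_one, Module.End.one_apply] at h2
    simp only [casimir, map_add, map_mul, LinearMap.add_apply, Module.End.mul_apply, h.ha, h.hd, h.he,
      map_smul, map_zero, h2]
    push_cast
    module
  rw [← Module.End.mul_apply, ← map_mul, casimir_mul, map_mul, Module.End.mul_apply, hq, map_smul]

/-! ### Families of highest weight vectors -/

theorem UIso.of_injective {n : ℕ} {M N : Type} [AddCommGroup M] [Module ℂ M]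
    [LieRingModule (Gl n) M] [LieModule ℂ (Gl n) M] [AddCommGroup N] [Module ℂ N]
    [LieRingModule (Gl n) N] [LieModule ℂ (Gl n) N] (f : M →ₗ⁅ℂ, Gl n⁆ N)
    (W : LieSubmodule ℂ (Gl n) N) (hf : Function.Injective f)
    (hW : LinearMap.range (f : M →ₗ[ℂ] N) = W.toSubmodule) : UIso n M W := by
  have hm : ∀ m, f m ∈ W := fun m => by
    change f m ∈ W.toSubmodule
    rw [← hW]; exact ⟨m, rfl⟩
  refine UIso.of_lieModuleEquiv
    { LinearEquiv.ofBijective ((f : M →ₗ[ℂ] N).codRestrict W.toSubmodule hm) ⟨?_, ?_⟩ with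
      map_lie' := fun {x m} => Subtype.ext (f.map_lie x m) }
  · intro x y hxy
    exact hf (congrArg Subtype.val hxy)
  · rintro ⟨y, hy⟩
    have : y ∈ LinearMap.range (f : M →ₗ[ℂ] N) := hW ▸ hy
    obtain ⟨x, rfl⟩ := this
    exact ⟨x, rfl⟩

section

variable {M : Type} [AddCommGroup M] [Module ℂ M] [LieRingModule (Gl 2) M] [LieModule ℂ (Gl 2) M]

/-- Dominant highest weight vectors `v i` with the same central character of the center of `gl_2`
and distinct highest weights. -/
structure IsDominantFamily {ι : Type} (a b : ι → ℂ) (n : ι → ℕ) (v : ι → M) : Prop where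
  dominant : ∀ i, IsDominant (a i) (b i) (n i) (v i)
  add_eq : ∀ i j, a i + b i = a j + b j
  inj : Function.Injective n

namespace IsDominantFamily

variable {ι : Type} {a b : ι → ℂ} {n : ι → ℕ} {v : ι → M}

/-- With `c = a + b` fixed and `a - b = n`, twice the Casimir eigenvalue is `c^2 + n^2 + 2n`, which
is strictly increasing in the natural number `n`. -/
theorem casimir_injective (h : IsDominantFamily a b n v) :
    Function.Injective fun i => a i * a i + b i * b i + (a i - b i) := by
  intro i j hij
  apply h.inj
  have h1 := (h.dominant i).sub_eq
  have h2 := (h.dominant j).sub_eq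
  have h3 := h.add_eq i j
  have h4 : (n i : ℂ) * n i + 2 * n i = n j * n j + 2 * n j := by
    rw [← h1, ← h2]
    simp only at hij
    linear_combination 2 * hij - (a i + b i + (a j + b j)) * h3
  have h5 : n i * n i + 2 * n i = n j * n j + 2 * n j := by exact_mod_cast h4
  nlinarith

theorem casimir_apply (h : IsDominantFamily a b n v) {i : ι} {x : M} (hx : x ∈ cyclic 2 (v i)) :
    uAct 2 M casimir x = (a i * a i + b i * b i + (a i - b i)) • x := by
  obtain ⟨u, rfl⟩ := mem_cyclic.mp hx
  exact (h.dominant i).casimir_apply u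

theorem iSupIndep (h : IsDominantFamily a b n v) :
    iSupIndep fun i => (cyclic 2 (v i)).toSubmodule := by
  refine ((uAct 2 M casimir).eigenspaces_iSupIndep.comp h.casimir_injective).mono ?_
  intro i x hx
  exact Module.End.mem_eigenspace_iff.mpr (h.casimir_apply hx)

theorem uIso_directSum (h : IsDominantFamily a b n v) :
    UIso 2 (⨁ i, HW 2 ![a i, b i]) (⨆ i, cyclic 2 (v i) : LieSubmodule ℂ (Gl 2) M) := by
  classical
  let e' := fun i => Classical.choice ((h.dominant i).exists_hwEquiv)
  let f : (⨁ i, HW 2 ![a i, b i]) →ₗ[ℂ] M :=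
    (DFinsupp.lsum ℕ (fun i => (cyclic 2 (v i)).toSubmodule.subtype)).comp
      (DFinsupp.mapRange.linearMap fun i => (e' i).toLinearEquiv.toLinearMap)
  have hof : ∀ i x, f (DirectSum.of _ i x) = e' i x := by
    intro i x
    change (DFinsupp.lsum ℕ (fun i => (cyclic 2 (v i)).toSubmodule.subtype))
      (DFinsupp.mapRange.linearMap (fun i => (e' i).toLinearEquiv.toLinearMap)
        (DFinsupp.single i x)) = _
    erw [DFinsupp.mapRange.linearMap_apply, DFinsupp.mapRange_single, DFinsupp.lsum_single]
    rfl
  let F : (⨁ i, HW 2 ![a i, b i]) →ₗ⁅ℂ, Gl 2⁆ M :=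
    { f with
      map_lie' := by
        intro x m
        change f ⁅x, m⁆ = ⁅x, f m⁆
        induction m using DirectSum.induction_on with
        | zero => simp
        | add m m' hm hm' => rw [lie_add, map_add, map_add, hm, hm', lie_add]
        | of i m =>
          have : ⁅x, DirectSum.of (fun i => HW 2 ![a i, b i]) i m⁆ =
              DirectSum.of (fun i => HW 2 ![a i, b i]) i ⁅x, m⁆ :=
            ((DirectSum.lieModuleOf ℂ ι (Gl 2) (fun i => HW 2 ![a i, b i]) i).map_lie x m).symm
          rw [this, hof, hof]
          exact congrArg Subtype.val ((e' i).toLieModuleHom.map_lie x m) }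
  refine UIso.of_injective F _ ?_ ?_
  · have h1 := h.iSupIndep.dfinsupp_lsum_injective
    refine h1.comp ?_
    intro x y hxy
    refine DFinsupp.ext fun i => ?_
    have := congrArg (fun z => z i) hxy
    exact (e' i).injective this
  · rw [LieSubmodule.iSup_toSubmodule]
    change LinearMap.range f = _
    rw [Submodule.iSup_eq_range_dfinsupp_lsum, LinearMap.range_comp, LinearMap.range_eq_top.mpr,
      Submodule.map_top]
    intro y
    refine ⟨DFinsupp.mapRange.linearMap (fun i => (e' i).toLinearEquiv.symm.toLinearMap) y, ?_⟩
    refine DFinsupp.ext fun i => ?_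
    exact (e' i).apply_symm_apply (y i)

variable [Fintype ι]

theorem finrank_iSup (h : IsDominantFamily a b n v) :
    Module.finrank ℂ (⨆ i, cyclic 2 (v i) : LieSubmodule ℂ (Gl 2) M) = ∑ i, (n i + 1) := by
  obtain ⟨e, -⟩ := h.uIso_directSum
  have hfin : ∀ i, Module.finrank ℂ (HW 2 ![a i, b i]) = n i + 1 := fun i => by
    obtain ⟨e⟩ := (h.dominant i).exists_hwEquiv
    rw [e.toLinearEquiv.finrank_eq, (h.dominant i).finrank]
  have : ∀ i, Module.Finite ℂ (HW 2 ![a i, b i]) := fun i => by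
    obtain ⟨e⟩ := (h.dominant i).exists_hwEquiv
    have := (h.dominant i).finite
    exact Module.Finite.equiv e.toLinearEquiv.symm
  rw [← e.finrank_eq, Module.finrank_directSum]
  exact Finset.sum_congr rfl fun i _ => hfin i

/-- A module of the right dimension mapping onto the span of all `v i` is isomorphic to the sum of
the modules generated by the `v i`. -/
theorem range_eq_and_uIso (h : IsDominantFamily a b n v) {S : Type} [AddCommGroup S] [Module ℂ S]
    [LieRingModule (Gl 2) S] [LieModule ℂ (Gl 2) S] [FiniteDimensional ℂ S]
    (T : S →ₗ⁅ℂ, Gl 2⁆ M) (hT : ∀ i, v i ∈ LinearMap.range (T : S →ₗ[ℂ] M))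
    (hS : Module.finrank ℂ S ≤ ∑ i, (n i + 1)) :
    LinearMap.range (T : S →ₗ[ℂ] M) = (⨆ i, cyclic 2 (v i) : LieSubmodule ℂ (Gl 2) M).toSubmodule ∧
      UIso 2 S (⨆ i, cyclic 2 (v i) : LieSubmodule ℂ (Gl 2) M) := by
  have hle : (⨆ i, cyclic 2 (v i) : LieSubmodule ℂ (Gl 2) M) ≤ T.range := by
    refine iSup_le fun i => cyclic_le.mpr ?_
    obtain ⟨s, hs⟩ := hT i
    exact ⟨s, hs⟩
  have hle' : (⨆ i, cyclic 2 (v i) : LieSubmodule ℂ (Gl 2) M).toSubmodule ≤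
      LinearMap.range (T : S →ₗ[ℂ] M) := by
    intro x hx
    obtain ⟨s, hs⟩ := hle hx
    exact ⟨s, hs⟩
  -- The chain `∑ (n i + 1) ≤ dim range ≤ dim S ≤ ∑ (n i + 1)` collapses. This gives surjectivity
  -- onto the sum and injectivity at once, so only an upper bound on `dim S` is ever needed.
  have h1 := LinearMap.finrank_range_add_finrank_ker (T : S →ₗ[ℂ] M)
  have h2 := Submodule.finrank_mono hle'
  have h3 := h.finrank_iSup
  change Module.finrank ℂ (⨆ i, cyclic 2 (v i) : LieSubmodule ℂ (Gl 2) M).toSubmodule = _ at h3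
  have heq := (Submodule.eq_of_le_of_finrank_eq hle' (by omega)).symm
  refine ⟨heq, UIso.of_injective T _ ?_ heq⟩
  have hk : Module.finrank ℂ (LinearMap.ker (T : S →ₗ[ℂ] M)) = 0 := by omega
  exact LinearMap.ker_eq_bot.mp (Submodule.finrank_eq_zero.mp hk)

/-- If `w` pairs nontrivially with an element of the module generated by `v i`, then the module
generated by `w` contains `v i`. -/
theorem mem_cyclic_of_pairing (h : IsDominantFamily a b n v) (B : M →ₗ[ℂ] M →ₗ[ℂ] ℂ)
    (hB : ∀ x y, B (uAct 2 M casimir x) y = B x (uAct 2 M casimir y)) {w z : M}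
    (hw : w ∈ (⨆ i, cyclic 2 (v i) : LieSubmodule ℂ (Gl 2) M)) {i : ι} (hz : z ∈ cyclic 2 (v i))
    (hwz : B w z ≠ 0) : v i ∈ cyclic 2 w := by
  classical
  have hw' : w ∈ ⨆ i, (cyclic 2 (v i)).toSubmodule := by
    rw [← LieSubmodule.iSup_toSubmodule]; exact hw
  obtain ⟨x, hx⟩ := (Submodule.mem_iSup_iff_exists_dfinsupp' _ _).mp hw'
  have hx' : ∑ j, (x j : M) = w := by
    rw [← hx, DFinsupp.sum_eq_sum_fintype _ (fun _ => rfl)]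
    rfl
  -- Distinct Casimir eigenvalues place each component of `w` in the cyclic module of `w`; by
  -- irreducibility it remains to see that the `i`-th component is nonzero.
  have key := mem_of_sum_eigenvectors_mem (uAct 2 M casimir) (cyclic 2 w).toSubmodule
    (fun y hy => uAct_mem hy _) _ (fun j => (x j : M)) Finset.univ
    (h.casimir_injective.injOn) (fun j _ => h.casimir_apply (x j).2)
    (by rw [hx']; exact self_mem_cyclic w) i (Finset.mem_univ _)
  refine (h.dominant i).mem_of_mem (x i).2 ?_ key
  intro h0
  apply hwz
  rw [← hx', map_sum, LinearMap.sum_apply]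
  refine Finset.sum_eq_zero fun j _ => ?_
  rcases eq_or_ne j i with rfl | hji
  · rw [h0]; simp
  -- Components with different Casimir eigenvalues are orthogonal, as the Casimir element is
  -- self-adjoint for `B`.
  · have := hB (x j) z
    rw [h.casimir_apply (x j).2, h.casimir_apply hz, map_smul, map_smul, LinearMap.smul_apply,
      smul_eq_mul, smul_eq_mul, ← sub_eq_zero, ← sub_mul, mul_eq_zero, sub_eq_zero] at this
    exact this.resolve_left fun hc => hji (h.casimir_injective hc)

end IsDominantFamily

end

/-! ### The dimension of symmetric powers -/

section

variable (V : Type) [AddCommGroup V] [Module ℂ V] [LieRingModule (Gl 2) V]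
  [LieModule ℂ (Gl 2) V]

open Pointwise in
theorem symPow_le_span (l : ℕ) {r : ℕ} (b : Module.Basis (Fin r) ℂ V) :
    (SymPow 2 V l).toSubmodule ≤ Submodule.span ℂ (Set.range fun s : Sym (Fin r) l =>
      ((s : Multiset (Fin r)).map fun i => SymmetricAlgebra.ι ℂ V (b i)).prod) := by
  have h1 : LinearMap.range (SymmetricAlgebra.ι ℂ V) =
      Submodule.span ℂ (Set.range fun i => SymmetricAlgebra.ι ℂ V (b i)) := by
    rw [← Submodule.map_top, ← b.span_eq, Submodule.map_span, ← Set.range_comp]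
    rfl
  change LinearMap.range (SymmetricAlgebra.ι ℂ V) ^ l ≤ _
  rw [h1, Submodule.span_pow]
  apply Submodule.span_mono
  induction l with
  | zero =>
    intro x hx
    refine ⟨Sym.nil, ?_⟩
    simp at hx
    simp [hx]
  | succ l ih =>
    rw [pow_succ']
    rintro _ ⟨_, ⟨i, rfl⟩, y, hy, rfl⟩
    obtain ⟨s, rfl⟩ := ih hy
    exact ⟨i ::ₛ s, by simp only [Sym.coe_cons, Multiset.map_cons, Multiset.prod_cons]⟩

variable [FiniteDimensional ℂ V]

instance finiteDimensional_symPow (l : ℕ) : FiniteDimensional ℂ (SymPow 2 V l) :=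
  have := FiniteDimensional.span_of_finite ℂ (Set.finite_range fun s : Sym (Fin (Module.finrank ℂ V)) l =>
      ((s : Multiset _).map fun i => SymmetricAlgebra.ι ℂ V (Module.finBasis ℂ V i)).prod)
  Submodule.finiteDimensional_of_le (symPow_le_span V l (Module.finBasis ℂ V))

theorem finrank_symPow_le (l : ℕ) :
    Module.finrank ℂ (SymPow 2 V l) ≤ (Module.finrank ℂ V).multichoose l := by
  have := FiniteDimensional.span_of_finite ℂ (Set.finite_range fun s : Sym (Fin (Module.finrank ℂ V)) l =>
      ((s : Multiset _).map fun i => SymmetricAlgebra.ι ℂ V (Module.finBasis ℂ V i)).prod)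
  refine (Submodule.finrank_mono (symPow_le_span V l (Module.finBasis ℂ V))).trans ?_
  refine (finrank_range_le_card _).trans_eq ?_
  rw [Sym.card_sym_eq_multichoose, Fintype.card_fin]

end

open MvPolynomial

/-! ### The apolar pairing -/

/-- The apolar pairing of polynomials, for which distinct monomials are orthogonal and `x^m` has
square `m!`. -/
def apolar : PolyMat 2 →ₗ[ℂ] PolyMat 2 →ₗ[ℂ] ℂ :=
  (basisMonomials (Fin 2 × Fin 2) ℂ).constr ℂ fun m =>
    (∏ p, ((m p).factorial : ℂ)) • lcoeff ℂ m

theorem apolar_monomial (m : Fin 2 × Fin 2 →₀ ℕ) (c : ℂ) (g : PolyMat 2) :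
    apolar (monomial m c) g = c * (∏ p, ((m p).factorial : ℂ)) * coeff m g := by
  have h : (monomial m c : PolyMat 2) = c • basisMonomials (Fin 2 × Fin 2) ℂ m := by
    rw [coe_basisMonomials, smul_monomial, smul_eq_mul, mul_one]
  rw [h, map_smul, apolar, Module.Basis.constr_basis]
  simp [mul_assoc]

theorem apolar_comm (f g : PolyMat 2) : apolar f g = apolar g f := by
  induction f using MvPolynomial.induction_on' with
  | add p q hp hq => simp [hp, hq]
  | monomial m c =>
    induction g using MvPolynomial.induction_on' with
    | add p q hp hq => rw [map_add, hp, hq, map_add, LinearMap.add_apply]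
    | monomial m' c' =>
      classical
      rw [apolar_monomial, apolar_monomial, coeff_monomial, coeff_monomial]
      by_cases h : m = m'
      · subst h; simp; ring
      · rw [if_neg (Ne.symm h), if_neg h]; simp

/-- Multiplication by a variable is adjoint to differentiation, because raising one exponent
multiplies `m!` by `m p + 1`. -/
theorem apolar_X_mul (p : Fin 2 × Fin 2) (f g : PolyMat 2) :
    apolar (X p * f) g = apolar f (pderiv p g) := by
  induction f using MvPolynomial.induction_on' with
  | add f f' hp hq => simp [mul_add, hp, hq]
  | monomial m c =>
    classical
    rw [X, monomial_mul, one_mul, apolar_monomial, apolar_monomial, coeff_pderiv, add_comm _ m]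
    have : ∏ q, (((m + Finsupp.single p 1 : Fin 2 × Fin 2 →₀ ℕ) q).factorial : ℂ) =
        (m p + 1) * ∏ q, ((m q).factorial : ℂ) := by
      rw [← Finset.mul_prod_erase _ _ (Finset.mem_univ p),
        ← Finset.mul_prod_erase Finset.univ (fun q => ((m q).factorial : ℂ)) (Finset.mem_univ p),
        ← mul_assoc]
      congr 1
      · simp [Nat.factorial_succ]
      · refine Finset.prod_congr rfl fun q hq => ?_
        rw [Finsupp.add_apply, Finsupp.single_eq_of_ne (Finset.ne_of_mem_erase hq), add_zero]
    rw [this]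
    ring

theorem apolar_pderiv (p : Fin 2 × Fin 2) (f g : PolyMat 2) :
    apolar (pderiv p f) g = apolar f (X p * g) := by
  rw [apolar_comm f, apolar_X_mul, apolar_comm]

theorem polarization_single (i j : Fin 2) (f : PolyMat 2) :
    polarization 2 (Matrix.single i j 1) f = ∑ k, X (i, k) * pderiv (j, k) f := by
  rw [polarization_apply, Finset.sum_eq_single i, Finset.sum_eq_single j]
  · simp
  · intro k _ hk; simp [hk.symm]
  · simp
  · intro k _ hk
    refine Finset.sum_eq_zero fun j' _ => ?_
    simp [hk.symm]
  · simp

theorem apolar_polarization (i j : Fin 2) (f g : PolyMat 2) :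
    apolar (polarization 2 (Matrix.single i j 1) f) g =
      apolar f (polarization 2 (Matrix.single j i 1) g) := by
  simp only [polarization_single, map_sum, LinearMap.sum_apply, apolar_X_mul, apolar_pderiv]

/-! ### Powers of the `α`-determinant -/

/-- The polynomial `x_{11} x_{22} + α x_{21} x_{12}`. -/
def detPoly (α : ℂ) : PolyMat 2 := X (0, 0) * X (1, 1) + C α * (X (1, 0) * X (0, 1))

/-- The polynomial `x_{11} x_{12}`. -/
def rowPoly : PolyMat 2 := X (0, 0) * X (0, 1)

theorem alphaDet_eq (α : ℂ) : alphaDet α (genX 2) = detPoly α := by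
  have h : (Finset.univ : Finset (Equiv.Perm (Fin 2))) = {1, Equiv.swap 0 1} := by decide
  have h1 : nu (1 : Equiv.Perm (Fin 2)) = 0 := by
    simp [nu, Equiv.Perm.parts_partition]
  have h2 : nu (Equiv.swap 0 1 : Equiv.Perm (Fin 2)) = 1 := by
    have hs : (Equiv.swap (0 : Fin 2) 1).cycleType = {2} :=
      (Equiv.Perm.IsSwap.isCycle ⟨0, 1, by decide, rfl⟩).cycleType.trans (by
        rw [Equiv.Perm.card_support_swap (by decide)])
    simp [nu, Equiv.Perm.parts_partition, hs]
  rw [alphaDet, h, Finset.sum_pair (by decide), h1, h2, detPoly]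
  simp [Fin.prod_univ_two, smul_eq_C_mul]

theorem det_eq : (genX 2).det = detPoly (-1) := by
  rw [Matrix.det_fin_two, detPoly]
  simp
  ring

theorem permanent_eq : (genX 2).permanent = detPoly 1 := by
  have h : (Finset.univ : Finset (Equiv.Perm (Fin 2))) = {1, Equiv.swap 0 1} := by decide
  rw [Matrix.permanent, h, Finset.sum_pair (by decide), detPoly]
  simp [Fin.prod_univ_two]

/-- The exponent vector of `(x_{11} x_{12})^n (x_{11} x_{22})^{s-k} (x_{21} x_{12})^k`. -/
def expVec (n s k : ℕ) : Fin 2 × Fin 2 →₀ ℕ :=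
  Finsupp.single (0, 0) (n + (s - k)) + Finsupp.single (0, 1) (n + k) +
    Finsupp.single (1, 0) k + Finsupp.single (1, 1) (s - k)

theorem rowPoly_pow_mul_detPoly_pow (n s : ℕ) (α : ℂ) :
    rowPoly ^ n * detPoly α ^ s =
      ∑ k ∈ Finset.range (s + 1), monomial (expVec n s k) ((s.choose k : ℂ) * α ^ k) := by
  rw [rowPoly, detPoly, add_comm, add_pow, Finset.mul_sum]
  refine Finset.sum_congr rfl fun k _ => ?_
  have h : (monomial (expVec n s k) ((s.choose k : ℂ) * α ^ k) : PolyMat 2) =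
      C ((s.choose k : ℂ) * α ^ k) * (X (0, 0) ^ (n + (s - k)) * X (0, 1) ^ (n + k) *
        X (1, 0) ^ k * X (1, 1) ^ (s - k)) := by
    simp only [X_pow_eq_monomial, monomial_mul, C_mul_monomial, mul_one, expVec]
  rw [h]
  simp only [map_mul, map_pow, map_natCast]
  ring

/-- Both sides expand in the same monomials by the binomial theorem. The weight `(n+s-k)! (n+k)! k!
(s-k)!` of each monomial combines with the two factors `s.choose k` to give the binomials of the
Gegenbauer coefficient. -/
theorem apolar_rowPoly_detPoly (n s : ℕ) (α : ℂ) :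
    apolar (rowPoly ^ n * detPoly α ^ s) (rowPoly ^ n * detPoly (-1) ^ s) =
      ((s.factorial : ℂ) ^ 2 * (n.factorial : ℂ) ^ 2) *
        ∑ k ∈ Finset.range (s + 1),
          ((n + k).choose n : ℂ) * ((n + (s - k)).choose n : ℂ) * (-α) ^ k := by
  classical
  rw [rowPoly_pow_mul_detPoly_pow n s α, map_sum, LinearMap.sum_apply, Finset.mul_sum]
  refine Finset.sum_congr rfl fun k hk => ?_
  have hks : k ≤ s := by simp at hk; omega
  rw [apolar_monomial]
  -- The exponent of `x_21` is `k`, so it identifies the monomial.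
  have hinj : ∀ j, expVec n s j = expVec n s k → j = k := by
    intro j hj
    have := DFunLike.congr_fun hj (1, 0)
    simpa [expVec] using this
  have hc : coeff (expVec n s k) (rowPoly ^ n * detPoly (-1) ^ s) = (s.choose k : ℂ) * (-1) ^ k := by
    rw [rowPoly_pow_mul_detPoly_pow, coeff_sum, Finset.sum_eq_single k]
    · simp
    · intro j _ hj
      rw [coeff_monomial, if_neg fun h => hj (hinj j h)]
    · intro h; exact absurd hk h
  have hp : ∏ p, ((expVec n s k p).factorial : ℂ) = (n + (s - k)).factorial * (n + k).factorial *
      (k.factorial * (s - k).factorial) := by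
    rw [Fintype.prod_prod_type]
    simp [Fin.prod_univ_two, expVec]
  rw [hc, hp]
  have e1 : ((s.choose k : ℕ) : ℂ) * k.factorial * (s - k).factorial = s.factorial := by
    exact_mod_cast Nat.choose_mul_factorial_mul_factorial hks
  have e2 : (((n + k).choose n : ℕ) : ℂ) * n.factorial * k.factorial = (n + k).factorial := by
    have := Nat.choose_mul_factorial_mul_factorial (Nat.le_add_right n k)
    rw [Nat.add_sub_cancel_left] at this
    exact_mod_cast this
  have e3 : (((n + (s - k)).choose n : ℕ) : ℂ) * n.factorial * (s - k).factorial =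
      (n + (s - k)).factorial := by
    have := Nat.choose_mul_factorial_mul_factorial (Nat.le_add_right n (s - k))
    rw [Nat.add_sub_cancel_left] at this
    exact_mod_cast this
  rw [← e2, ← e3, ← e1, neg_pow]
  ring

/-! ### Highest weight vectors in the polynomial ring -/

theorem uAct_eU (i j : Fin 2) (f : PolyMat 2) :
    uAct 2 (PolyMat 2) (eU i j) f = polarization 2 (Matrix.single i j 1) f := uAct_ι _ f

theorem polarization_single_X (i j p q : Fin 2) :
    polarization 2 (Matrix.single i j 1) (X (p, q)) = if j = p then X (i, q) else 0 := by
  rw [polarization_X, Finset.sum_eq_single i]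
  · by_cases h : j = p <;> simp [h]
  · intro k _ hk
    simp [hk.symm]
  · simp

theorem derivation_pow_mul_pow (D : Derivation ℂ (PolyMat 2) (PolyMat 2)) {f g : PolyMat 2}
    {c d : ℂ} (hf : D f = c • f) (hg : D g = d • g) (m k : ℕ) :
    D (f ^ m * g ^ k) = (m * c + k * d) • (f ^ m * g ^ k) := by
  have hp : ∀ (h : PolyMat 2) (e : ℂ), D h = e • h → ∀ n : ℕ, D (h ^ n) = (n * e) • h ^ n := by
    intro h e he n
    induction n with
    | zero => simp
    | succ n ih =>
      rw [pow_succ, Derivation.leibniz, ih, he]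
      simp only [smul_eq_C_mul, smul_eq_mul]
      push_cast
      simp only [map_mul, map_add, map_one, map_natCast]
      ring
  rw [Derivation.leibniz, hp f c hf, hp g d hg]
  simp only [smul_eq_C_mul, smul_eq_mul, map_mul, map_add]
  ring

theorem polarization_rowPoly (i j : Fin 2) :
    polarization 2 (Matrix.single i j 1) rowPoly =
      if j = 0 then X (0, 0) * X (i, 1) + X (i, 0) * X (0, 1) else 0 := by
  rw [rowPoly, Derivation.leibniz, polarization_single_X, polarization_single_X]
  by_cases h : j = 0 <;> simp [h]
  ring

theorem polarization_detPoly (α : ℂ) (i j : Fin 2) :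
    polarization 2 (Matrix.single i j 1) (detPoly α) =
      if j = 0 then X (i, 0) * X (1, 1) + C α * (X (1, 0) * X (i, 1))
      else X (0, 0) * X (i, 1) + C α * (X (i, 0) * X (0, 1)) := by
  rw [detPoly, map_add, Derivation.leibniz, Derivation.leibniz, Derivation.leibniz]
  simp only [polarization_single_X]
  have hC : polarization 2 (Matrix.single i j 1) (C α) = 0 :=
    (polarization 2 (Matrix.single i j 1)).map_algebraMap α
  rw [hC]
  obtain rfl | rfl : j = 0 ∨ j = 1 := by omega
  all_goals
    simp only [one_ne_zero, zero_ne_one, if_true, if_false, smul_eq_mul, mul_zero,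
      add_zero, zero_add]
    ring

theorem detPoly_ne_zero (α : ℂ) : detPoly α ≠ 0 := by
  intro h
  have := congrArg (MvPolynomial.eval fun p : Fin 2 × Fin 2 => if p.1 = p.2 then (1 : ℂ) else 0) h
  simp [detPoly] at this

theorem rowPoly_ne_zero : rowPoly ≠ 0 := mul_ne_zero (X_ne_zero _) (X_ne_zero _)

theorem isHighest_rowPoly_detPoly (m k : ℕ) :
    IsHighest (uAct 2 (PolyMat 2)) (2 * m + k) k (rowPoly ^ m * detPoly (-1) ^ k) := by
  refine ⟨?_, ?_, ?_⟩ <;> rw [uAct_eU]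
  · rw [derivation_pow_mul_pow _ (c := 0) (d := 0)]
    · simp
    · simp [polarization_rowPoly]
    · rw [polarization_detPoly]; simp
  · rw [derivation_pow_mul_pow _ (c := 2) (d := 1)]
    · congr 1; ring
    · rw [polarization_rowPoly, if_pos rfl, rowPoly, smul_eq_C_mul, map_ofNat]; ring
    · rw [polarization_detPoly, if_pos rfl, detPoly, one_smul]
  · rw [derivation_pow_mul_pow _ (c := 0) (d := 1)]
    · congr 1; ring
    · simp [polarization_rowPoly]
    · rw [polarization_detPoly, if_neg (by decide), detPoly, one_smul]

/-- The ambient polynomial ring is infinite-dimensional, so the vanishing of `F^(n+1) v` is obtained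
inside `W` and transported back. -/
theorem IsHighest.isDominant {M : Type} [AddCommGroup M] [Module ℂ M] [LieRingModule (Gl 2) M]
    [LieModule ℂ (Gl 2) M] {a b : ℂ} {v : M} (h : IsHighest (uAct 2 M) a b v) (hv : v ≠ 0) {n : ℕ}
    (hn : a - b = n) {W : LieSubmodule ℂ (Gl 2) M} [FiniteDimensional ℂ W] (hW : v ∈ W) :
    IsDominant a b n v := by
  have hinc : ∀ (u : Ugl 2) (w : W), ((uAct 2 W u w : W) : M) = uAct 2 M u w :=
    fun u w => map_uAct W.incl u w
  have h' : IsHighest (uAct 2 W) a b ⟨v, hW⟩ :=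
    ⟨Subtype.ext ((hinc _ _).trans h.he), Subtype.ext ((hinc _ _).trans h.ha),
      Subtype.ext ((hinc _ _).trans h.hd)⟩
  refine ⟨h, hv, hn, ?_⟩
  have := congrArg Subtype.val (h'.F_pow_eq_zero hn)
  rwa [hinc] at this

theorem isDominant_rowPoly_detPoly (m k : ℕ) {W : LieSubmodule ℂ (Gl 2) (PolyMat 2)}
    [FiniteDimensional ℂ W] (hW : rowPoly ^ m * detPoly (-1) ^ k ∈ W) :
    IsDominant (2 * m + k : ℂ) k (2 * m) (rowPoly ^ m * detPoly (-1) ^ k) :=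
  (isHighest_rowPoly_detPoly m k).isDominant
    (mul_ne_zero (pow_ne_zero _ rowPoly_ne_zero) (pow_ne_zero _ (detPoly_ne_zero _)))
    (by push_cast; ring) hW

/-! ### The component of `detPoly α ^ l` -/

/-- The derivation `E_12` kills `rowPoly` and sends `detPoly α` to `(1 + α) • rowPoly`, so each
application trades one factor `detPoly α` for `rowPoly`. -/
theorem raise_detPoly_pow (α : ℂ) (l n : ℕ) (hn : n ≤ l) :
    uAct 2 (PolyMat 2) (eU 0 1 ^ n) (detPoly α ^ l) =
      (l.descFactorial n * (1 + α) ^ n : ℂ) • (rowPoly ^ n * detPoly α ^ (l - n)) := by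
  have hr : polarization 2 (Matrix.single 0 1 1) rowPoly = 0 := by
    simp [polarization_rowPoly]
  have hd : polarization 2 (Matrix.single 0 1 1) (detPoly α) = (1 + α) • rowPoly := by
    rw [polarization_detPoly, if_neg (by decide), rowPoly, smul_eq_C_mul, map_add, map_one]
    ring
  induction n with
  | zero => simp
  | succ n ih =>
    rw [pow_succ', map_mul, Module.End.mul_apply, ih (by omega), map_smul, uAct_eU,
      Derivation.leibniz, Derivation.leibniz_pow, Derivation.leibniz_pow, hr, hd,
      show l - n = (l - (n + 1)) + 1 by omega, Nat.add_sub_cancel, Nat.descFactorial_succ,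
      show l - n = (l - (n + 1)) + 1 by omega]
    simp only [smul_eq_C_mul, smul_eq_mul, nsmul_eq_mul, map_mul, map_natCast, map_pow,
      map_add, map_one]
    push_cast
    simp only [mul_zero, add_zero]
    ring

theorem apolar_eU (i j : Fin 2) (f g : PolyMat 2) :
    apolar (uAct 2 (PolyMat 2) (eU i j) f) g = apolar f (uAct 2 (PolyMat 2) (eU j i) g) := by
  rw [uAct_eU, uAct_eU, apolar_polarization]

theorem apolar_eU_pow (n : ℕ) (f g : PolyMat 2) :
    apolar f (uAct 2 (PolyMat 2) (eU 1 0 ^ n) g) = apolar (uAct 2 (PolyMat 2) (eU 0 1 ^ n) f) g := by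
  induction n generalizing g with
  | zero => simp
  | succ n ih =>
    rw [pow_succ, map_mul, Module.End.mul_apply, ih, pow_succ', map_mul, Module.End.mul_apply,
      apolar_eU]

theorem apolar_casimir (f g : PolyMat 2) :
    apolar (uAct 2 (PolyMat 2) casimir f) g = apolar f (uAct 2 (PolyMat 2) casimir g) := by
  simp only [casimir, map_add, map_mul, LinearMap.add_apply, Module.End.mul_apply, apolar_eU]

theorem apolar_detPoly_pow (α : ℂ) (n s : ℕ) (hα : 1 + α ≠ 0)
    (hc : PowerSeries.coeff s (gegenbauerSeries n (-α)) ≠ 0) :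
    apolar (detPoly α ^ (n + s))
      (uAct 2 (PolyMat 2) (eU 1 0 ^ n) (rowPoly ^ n * detPoly (-1) ^ s)) ≠ 0 := by
  rw [apolar_eU_pow, raise_detPoly_pow α _ n (Nat.le_add_right n s), Nat.add_sub_cancel_left,
    map_smul, LinearMap.smul_apply, apolar_rowPoly_detPoly, ← coeff_gegenbauerSeries]
  have h1 : ((n + s).descFactorial n : ℂ) ≠ 0 := by
    rw [Nat.cast_ne_zero, Ne, Nat.descFactorial_eq_zero_iff_lt]
    omega
  exact smul_ne_zero (mul_ne_zero h1 (pow_ne_zero _ hα)) (mul_ne_zero (mul_ne_zero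
    (pow_ne_zero _ (Nat.cast_ne_zero.mpr (Nat.factorial_ne_zero _)))
    (pow_ne_zero _ (Nat.cast_ne_zero.mpr (Nat.factorial_ne_zero _)))) hc)

/-! ### Equivariant maps from symmetric powers to polynomials -/

section

variable {V : Type} [AddCommGroup V] [Module ℂ V] [LieRingModule (Gl 2) V] [LieModule ℂ (Gl 2) V]

/-- The equivariant extension to the symmetric algebra of an equivariant map to polynomials. -/
def symHom (g : V →ₗ⁅ℂ, Gl 2⁆ PolyMat 2) : SymmetricAlgebra ℂ V →ₗ⁅ℂ, Gl 2⁆ PolyMat 2 :=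
  { (SymmetricAlgebra.lift (g : V →ₗ[ℂ] PolyMat 2)).toLinearMap with
    map_lie' := by
      intro A s
      change SymmetricAlgebra.lift (g : V →ₗ[ℂ] PolyMat 2) (symDer 2 V A s) =
        polarization 2 A (SymmetricAlgebra.lift (g : V →ₗ[ℂ] PolyMat 2) s)
      induction s using SymmetricAlgebra.induction with
      | algebraMap r => simp
      | ι x =>
        rw [symDer_ι, SymmetricAlgebra.lift_ι_apply, SymmetricAlgebra.lift_ι_apply]
        exact g.map_lie A x
      | mul a b ha hb => simp [ha, hb]
      | add a b ha hb => simp [ha, hb] }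

theorem symHom_apply (g : V →ₗ⁅ℂ, Gl 2⁆ PolyMat 2) (s : SymmetricAlgebra ℂ V) :
    symHom g s = SymmetricAlgebra.lift (g : V →ₗ[ℂ] PolyMat 2) s := rfl

/-- The restriction of `symHom` to a symmetric power. -/
def symPowHom (l : ℕ) (g : V →ₗ⁅ℂ, Gl 2⁆ PolyMat 2) : SymPow 2 V l →ₗ⁅ℂ, Gl 2⁆ PolyMat 2 :=
  (symHom g).comp (SymPow 2 V l).incl

theorem range_symPowHom (l : ℕ) (g : V →ₗ⁅ℂ, Gl 2⁆ PolyMat 2) :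
    LinearMap.range (symPowHom l g : SymPow 2 V l →ₗ[ℂ] PolyMat 2) =
      LinearMap.range (g : V →ₗ[ℂ] PolyMat 2) ^ l := by
  have h1 : LinearMap.range (symPowHom l g : SymPow 2 V l →ₗ[ℂ] PolyMat 2) =
      Submodule.map (SymmetricAlgebra.lift (g : V →ₗ[ℂ] PolyMat 2)).toLinearMap
        (LinearMap.range (SymmetricAlgebra.ι ℂ V) ^ l) := by
    ext x
    constructor
    · rintro ⟨s, rfl⟩
      exact ⟨s.1, s.2, rfl⟩
    · rintro ⟨s, hs, rfl⟩
      exact ⟨⟨s, hs⟩, rfl⟩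
  rw [h1, Submodule.map_pow, ← LinearMap.range_comp]
  congr 2
  exact SymmetricAlgebra.lift_comp_ι _

end

/-- The equivariant map `e_i ↦ t_1 x_{i1} + t_2 x_{i2}`. -/
def colMap (t : Fin 2 → ℂ) : Nat1 2 →ₗ⁅ℂ, Gl 2⁆ PolyMat 2 where
  toFun v := ∑ i, v i • ∑ k, t k • X (i, k)
  map_add' v w := by simp only [Pi.add_apply, add_smul, Finset.sum_add_distrib]
  map_smul' c v := by simp [mul_smul]
  map_lie' := by
    intro A v
    change ∑ i, A.mulVec v i • ∑ k, t k • (X (i, k) : PolyMat 2) =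
      polarization 2 A (∑ i, v i • ∑ k, t k • (X (i, k) : PolyMat 2))
    simp only [map_add, Derivation.map_smul, polarization_X, Matrix.mulVec, dotProduct,
      Fin.sum_univ_two]
    module

theorem colMap_single (t : Fin 2 → ℂ) (i : Fin 2) :
    colMap t (Pi.single i 1) = t 0 • X (i, 0) + t 1 • X (i, 1) := by
  change ∑ j, (Pi.single i (1 : ℂ) : Fin 2 → ℂ) j • ∑ k, t k • (X (j, k) : PolyMat 2) = _
  rw [Finset.sum_eq_single i, Pi.single_eq_same, one_smul, Fin.sum_univ_two]
  · intro j _ hj; rw [Pi.single_eq_of_ne hj, zero_smul]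
  · simp

/-- The product map from `Sym^l ⊗ Sym^l` to polynomials, sending the first factor to polynomials in
the first column and the second factor to polynomials in the second column. -/
def tensorHom (l : ℕ) :
    SymPow 2 (Nat1 2) l ⊗[ℂ] SymPow 2 (Nat1 2) l →ₗ⁅ℂ, Gl 2⁆ PolyMat 2 :=
  { TensorProduct.lift ((LinearMap.mul ℂ (PolyMat 2)).compl₁₂
      (symPowHom l (colMap ![1, 0]) : SymPow 2 (Nat1 2) l →ₗ[ℂ] PolyMat 2)
      (symPowHom l (colMap ![0, 1]) : SymPow 2 (Nat1 2) l →ₗ[ℂ] PolyMat 2)) with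
    map_lie' := by
      intro A x
      change TensorProduct.lift _ ⁅A, x⁆ = ⁅A, TensorProduct.lift _ x⁆
      induction x using TensorProduct.induction_on with
      | zero => simp
      | add x y hx hy => rw [lie_add, map_add, map_add, lie_add, hx, hy]
      | tmul s t =>
        rw [TensorProduct.LieModule.lie_tmul_right, map_add]
        simp only [TensorProduct.lift.tmul, LinearMap.compl₁₂_apply, LinearMap.mul_apply']
        change symPowHom l (colMap ![1, 0]) ⁅A, s⁆ * symPowHom l (colMap ![0, 1]) t +
          symPowHom l (colMap ![1, 0]) s * symPowHom l (colMap ![0, 1]) ⁅A, t⁆ =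
          polarization 2 A (symPowHom l (colMap ![1, 0]) s * symPowHom l (colMap ![0, 1]) t)
        rw [Derivation.leibniz, LieModuleHom.map_lie, LieModuleHom.map_lie]
        change polarization 2 A _ * _ + _ * polarization 2 A _ = _
        simp only [smul_eq_mul]
        ring }

theorem le_range_tensorHom (l : ℕ) :
    (LinearMap.range (colMap ![1, 0] : Nat1 2 →ₗ[ℂ] PolyMat 2) *
      LinearMap.range (colMap ![0, 1] : Nat1 2 →ₗ[ℂ] PolyMat 2)) ^ l ≤
      LinearMap.range (tensorHom l).toLinearMap := by
  rw [mul_pow, ← range_symPowHom, ← range_symPowHom, Submodule.mul_le]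
  rintro _ ⟨s, rfl⟩ _ ⟨t, rfl⟩
  exact ⟨s ⊗ₜ t, rfl⟩

theorem X_mul_X_mem (i j : Fin 2) : (X (i, 0) * X (j, 1) : PolyMat 2) ∈
    LinearMap.range (colMap ![1, 0] : Nat1 2 →ₗ[ℂ] PolyMat 2) *
      LinearMap.range (colMap ![0, 1] : Nat1 2 →ₗ[ℂ] PolyMat 2) := by
  refine Submodule.mul_mem_mul ⟨Pi.single i 1, ?_⟩ ⟨Pi.single j 1, ?_⟩
  · exact (colMap_single _ i).trans (by simp)
  · exact (colMap_single _ j).trans (by simp)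

theorem detPoly_mem (α : ℂ) : detPoly α ∈
    LinearMap.range (colMap ![1, 0] : Nat1 2 →ₗ[ℂ] PolyMat 2) *
      LinearMap.range (colMap ![0, 1] : Nat1 2 →ₗ[ℂ] PolyMat 2) := by
  rw [detPoly, ← smul_eq_C_mul]
  exact add_mem (X_mul_X_mem 0 1) (Submodule.smul_mem _ _ (X_mul_X_mem 1 0))

theorem detPoly_pow_mem_range (α : ℂ) (l : ℕ) :
    detPoly α ^ l ∈ LinearMap.range (tensorHom l).toLinearMap :=
  le_range_tensorHom l (Submodule.pow_mem_pow _ (detPoly_mem α) l)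

theorem rowPoly_detPoly_mem_range (m k : ℕ) :
    rowPoly ^ m * detPoly (-1) ^ k ∈ LinearMap.range (tensorHom (m + k)).toLinearMap := by
  apply le_range_tensorHom
  rw [pow_add]
  exact Submodule.mul_mem_mul (Submodule.pow_mem_pow _ (X_mul_X_mem 0 0) m)
    (Submodule.pow_mem_pow _ (detPoly_mem (-1)) k)

/-- The polarization map `e_i e_j ↦ x_{i1} x_{j2} + x_{j1} x_{i2}`. -/
def polarizeHom : SymPow 2 (Nat1 2) 2 →ₗ⁅ℂ, Gl 2⁆ PolyMat 2 :=
  (1 / 2 : ℂ) • (symPowHom 2 (colMap ![1, 1]) - symPowHom 2 (colMap ![1, -1]))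

/-- In the half-difference of the substitutions `t = (1, 1)` and `t = (1, -1)`, terms from a single
column cancel and the mixed ones remain. -/
theorem polarize_mem (i j : Fin 2) : (X (i, 0) * X (j, 1) + X (j, 0) * X (i, 1) : PolyMat 2) ∈
    LinearMap.range polarizeHom.toLinearMap := by
  have hm : SymmetricAlgebra.ι ℂ (Nat1 2) (Pi.single i 1) *
      SymmetricAlgebra.ι ℂ (Nat1 2) (Pi.single j 1) ∈ SymPow 2 (Nat1 2) 2 := by
    change _ ∈ LinearMap.range (SymmetricAlgebra.ι ℂ (Nat1 2)) ^ 2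
    rw [pow_two]
    exact Submodule.mul_mem_mul ⟨_, rfl⟩ ⟨_, rfl⟩
  refine ⟨⟨_, hm⟩, ?_⟩
  have h : ∀ t, symPowHom 2 (colMap t) ⟨_, hm⟩ = (t 0 • X (i, 0) + t 1 • X (i, 1)) *
      (t 0 • X (j, 0) + t 1 • X (j, 1)) := by
    intro t
    have e : symPowHom 2 (colMap t) ⟨_, hm⟩ = symHom (colMap t)
        (SymmetricAlgebra.ι ℂ (Nat1 2) (Pi.single i 1) *
          SymmetricAlgebra.ι ℂ (Nat1 2) (Pi.single j 1)) := rfl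
    rw [e, symHom_apply, map_mul, SymmetricAlgebra.lift_ι_apply, SymmetricAlgebra.lift_ι_apply, ← colMap_single,
      ← colMap_single]
    rfl
  change (1 / 2 : ℂ) • (symPowHom 2 (colMap ![1, 1]) ⟨_, hm⟩ -
    symPowHom 2 (colMap ![1, -1]) ⟨_, hm⟩) = _
  rw [h, h]
  simp only [Matrix.cons_val_zero, Matrix.cons_val_one, one_smul, neg_smul]
  rw [show ∀ a b c d : PolyMat 2, (a + b) * (c + d) - (a + -b) * (c + -d) =
    (2 : ℂ) • (a * d + c * b) by intro a b c d; rw [smul_eq_C_mul, map_ofNat]; ring, smul_smul]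
  norm_num

/-- Only even powers of the determinant are treated: the relation `det^2 = per^2 - 4 (x_11
x_12)(x_21 x_22)` expresses `det^2` as a quadric in elements of `P`. -/
theorem rowPoly_detPoly_mem_range_polarize (m k : ℕ) :
    rowPoly ^ m * detPoly (-1) ^ (2 * k) ∈
      LinearMap.range (symPowHom (m + 2 * k) polarizeHom).toLinearMap := by
  set P := LinearMap.range polarizeHom.toLinearMap with hP
  have h2 : ∀ i : Fin 2, (X (i, 0) * X (i, 1) : PolyMat 2) ∈ P := by
    intro i
    have := P.smul_mem (1 / 2 : ℂ) (polarize_mem i i)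
    rwa [← two_smul ℂ, smul_smul, one_div, inv_mul_cancel₀ two_ne_zero, one_smul] at this
  have hd : detPoly (-1) ^ 2 ∈ P ^ 2 := by
    have : detPoly (-1) ^ 2 = (X (0, 0) * X (1, 1) + X (1, 0) * X (0, 1)) ^ 2 -
        (4 : ℂ) • ((X (0, 0) * X (0, 1)) * (X (1, 0) * X (1, 1))) := by
      rw [detPoly, smul_eq_C_mul, map_neg, map_one, map_ofNat]
      ring
    rw [this]
    refine sub_mem (Submodule.pow_mem_pow _ (polarize_mem 0 1) 2) (Submodule.smul_mem _ _ ?_)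
    rw [pow_two]
    exact Submodule.mul_mem_mul (h2 0) (h2 1)
  rw [range_symPowHom, pow_add, pow_mul, pow_mul]
  exact Submodule.mul_mem_mul (Submodule.pow_mem_pow _ (h2 0) m) (Submodule.pow_mem_pow _ hd k)

theorem permanent_pow_mem_range (l : ℕ) :
    detPoly 1 ^ l ∈ LinearMap.range (symPowHom l polarizeHom).toLinearMap := by
  rw [range_symPowHom]
  refine Submodule.pow_mem_pow _ ?_ l
  rw [detPoly, map_one, one_mul]
  exact polarize_mem 0 1

/-! ### The two decompositions -/

instance finiteDimensional_range {S : Type} [AddCommGroup S] [Module ℂ S] [LieRingModule (Gl 2) S]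
    [LieModule ℂ (Gl 2) S] [FiniteDimensional ℂ S] (T : S →ₗ⁅ℂ, Gl 2⁆ PolyMat 2) :
    FiniteDimensional ℂ T.range :=
  Module.Finite.of_surjective ((T : S →ₗ[ℂ] PolyMat 2).codRestrict T.range.toSubmodule
    fun x => ⟨x, rfl⟩) (by rintro ⟨_, x, rfl⟩; exact ⟨x, rfl⟩)

/-- The highest weight vector of weight `(2l - s, s)`. -/
def hwVec (l s : ℕ) : PolyMat 2 := rowPoly ^ (l - s) * detPoly (-1) ^ s

theorem isDominantFamily_hwVec (l : ℕ) :
    IsDominantFamily (fun s : Fin (l + 1) => 2 * (l : ℂ) - (s : ℕ)) (fun s => ((s : ℕ) : ℂ))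
      (fun s => 2 * (l - s)) fun s => hwVec l s := by
  refine ⟨fun s => ?_, fun i j => by ring, fun i j hij => Fin.ext (by simp at hij; omega)⟩
  have hs : (s : ℕ) ≤ l := by omega
  have h := isDominant_rowPoly_detPoly (l - s) s (W := (tensorHom (l - s + s)).range)
    (rowPoly_detPoly_mem_range _ _)
  rwa [show (2 * ((l - s : ℕ) : ℂ) + (s : ℕ)) = 2 * (l : ℂ) - (s : ℕ) by
    rw [Nat.cast_sub hs]; ring] at h

theorem isDominantFamily_hwVec_even (l : ℕ) :
    IsDominantFamily (fun j : Fin (l / 2 + 1) => 2 * (l : ℂ) - 2 * (j : ℕ))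
      (fun j => 2 * ((j : ℕ) : ℂ)) (fun j => 2 * (l - 2 * j)) fun j => hwVec l (2 * j) := by
  refine ⟨fun j => ?_, fun i j => by ring, fun i j hij => Fin.ext (by simp at hij; omega)⟩
  have := (isDominantFamily_hwVec l).dominant ⟨2 * j, by omega⟩
  simpa using this

theorem hwVec_mem_range {l s : ℕ} (hs : s ≤ l) :
    hwVec l s ∈ LinearMap.range (tensorHom l).toLinearMap := by
  have := rowPoly_detPoly_mem_range (l - s) s
  rwa [Nat.sub_add_cancel hs] at this

theorem hwVec_even_mem_range {l j : ℕ} (hj : 2 * j ≤ l) :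
    hwVec l (2 * j) ∈ LinearMap.range (symPowHom l polarizeHom).toLinearMap := by
  have := rowPoly_detPoly_mem_range_polarize (l - 2 * j) j
  rwa [Nat.sub_add_cancel hj] at this

/-- After the reflection `s ↦ l - s` the right side is the sum of the first `l+1` odd numbers, which
is `(l+1)^2`. -/
theorem finrank_tensor_le (l : ℕ) :
    Module.finrank ℂ (SymPow 2 (Nat1 2) l ⊗[ℂ] SymPow 2 (Nat1 2) l) ≤
      ∑ s : Fin (l + 1), (2 * (l - s) + 1) := by
  have h1 := finrank_symPow_le (Nat1 2) l
  rw [Module.finrank_fin_fun, Nat.multichoose_two] at h1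
  rw [Module.finrank_tensorProduct]
  refine (Nat.mul_le_mul h1 h1).trans_eq ?_
  rw [Fin.sum_univ_eq_sum_range (fun s => 2 * (l - s) + 1),
    ← Finset.sum_range_reflect]
  have : ∀ n : ℕ, ∑ j ∈ Finset.range n, (2 * j + 1) = n * n := by
    intro n
    induction n with
    | zero => rfl
    | succ n ih => rw [Finset.sum_range_succ, ih]; ring
  rw [← this]
  refine Finset.sum_congr rfl fun j hj => ?_
  simp at hj
  omega

/-- From `l` to `l+2` the left side grows by `(l+3) + (l+2) = 2(l+2)+1`, which is the `j = 0` term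
on the right; the other terms shift by one. -/
theorem multichoose_three (l : ℕ) :
    Nat.multichoose 3 l = ∑ j ∈ Finset.range (l / 2 + 1), (2 * (l - 2 * j) + 1) := by
  induction l using Nat.twoStepInduction with
  | zero => simp
  | one => simp
  | more l ih _ =>
    have e1 : Nat.multichoose 3 (l + 2) = Nat.multichoose 2 (l + 2) + Nat.multichoose 3 (l + 1) :=
      Nat.multichoose_succ_succ 2 (l + 1)
    have e2 : Nat.multichoose 3 (l + 1) = Nat.multichoose 2 (l + 1) + Nat.multichoose 3 l :=
      Nat.multichoose_succ_succ 2 l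
    rw [Nat.multichoose_two] at e1 e2
    have e3 : ∑ j ∈ Finset.range (l / 2 + 1), (2 * (l + 2 - 2 * (j + 1)) + 1) =
        ∑ j ∈ Finset.range (l / 2 + 1), (2 * (l - 2 * j) + 1) :=
      Finset.sum_congr rfl fun j _ => by omega
    rw [Nat.add_div_right _ two_pos, Finset.sum_range_succ', e3, ← ih]
    omega

theorem finrank_symPow_symPow_le (l : ℕ) :
    Module.finrank ℂ (SymPow 2 (SymPow 2 (Nat1 2) 2) l) ≤
      ∑ j : Fin (l / 2 + 1), (2 * (l - 2 * j) + 1) := by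
  have h1 := finrank_symPow_le (Nat1 2) 2
  rw [Module.finrank_fin_fun, Nat.multichoose_two] at h1
  have h2 := finrank_symPow_le (SymPow 2 (Nat1 2) 2) l
  refine h2.trans ?_
  have h3 : (Module.finrank ℂ (SymPow 2 (Nat1 2) 2)).multichoose l ≤ Nat.multichoose 3 l := by
    rw [Nat.multichoose_eq, Nat.multichoose_eq]
    exact Nat.choose_le_choose _ (by omega)
  refine h3.trans_eq ?_
  rw [Fin.sum_univ_eq_sum_range (fun j => 2 * (l - 2 * j) + 1), multichoose_three]

theorem UIso.of_eq {W W' : LieSubmodule ℂ (Gl 2) (PolyMat 2)} (h : W = W') : UIso 2 W W' := by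
  subst h
  exact ⟨LinearEquiv.refl ℂ W, fun _ _ => rfl⟩

theorem hwVec_mem_cyclic {ι : Type} [Fintype ι] {a b : ι → ℂ} {n : ι → ℕ} {l : ℕ} {σ : ι → ℕ}
    (h : IsDominantFamily a b n fun i => hwVec l (σ i)) {α : ℂ} (hα : 1 + α ≠ 0)
    (hw : detPoly α ^ l ∈ (⨆ i, cyclic 2 (hwVec l (σ i)) : LieSubmodule ℂ (Gl 2) (PolyMat 2)))
    (i : ι) (hi : σ i ≤ l)
    (hc : PowerSeries.coeff (σ i) (gegenbauerSeries (l - σ i) (-α)) ≠ 0) :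
    hwVec l (σ i) ∈ cyclic 2 (detPoly α ^ l) := by
  refine h.mem_cyclic_of_pairing apolar apolar_casimir hw (i := i)
    -- The test vector is the one of weight `(l, l)` in its module, matching the weight of `detPoly
    -- α ^ l`.
    (z := uAct 2 (PolyMat 2) (eU 1 0 ^ (l - σ i)) (hwVec l (σ i))) ⟨_, rfl⟩ ?_
  have := apolar_detPoly_pow α (l - σ i) (σ i) hα hc
  rwa [Nat.sub_add_cancel hi] at this

theorem tensorHom_range_and_uIso (l : ℕ) :
    LinearMap.range (tensorHom l).toLinearMap =
      (⨆ s : Fin (l + 1), cyclic 2 (hwVec l s) :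
        LieSubmodule ℂ (Gl 2) (PolyMat 2)).toSubmodule ∧
    UIso 2 (SymPow 2 (Nat1 2) l ⊗[ℂ] SymPow 2 (Nat1 2) l)
      (⨆ s : Fin (l + 1), cyclic 2 (hwVec l s) : LieSubmodule ℂ (Gl 2) (PolyMat 2)) :=
  (isDominantFamily_hwVec l).range_eq_and_uIso (tensorHom l)
    (fun s => hwVec_mem_range (Nat.le_of_lt_succ s.2)) (finrank_tensor_le l)

theorem symPowHom_range_and_uIso (l : ℕ) :
    LinearMap.range (symPowHom l polarizeHom).toLinearMap =
      (⨆ j : Fin (l / 2 + 1), cyclic 2 (hwVec l (2 * j)) :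
        LieSubmodule ℂ (Gl 2) (PolyMat 2)).toSubmodule ∧
    UIso 2 (SymPow 2 (SymPow 2 (Nat1 2) 2) l)
      (⨆ j : Fin (l / 2 + 1), cyclic 2 (hwVec l (2 * j)) :
        LieSubmodule ℂ (Gl 2) (PolyMat 2)) :=
  (isDominantFamily_hwVec_even l).range_eq_and_uIso (symPowHom l polarizeHom)
    (fun j => hwVec_even_mem_range (by omega)) (finrank_symPow_symPow_le l)

theorem cyclic_detPoly_pow {α : ℂ} (hα : ‖α‖ ≠ 1) (l : ℕ) :
    cyclic 2 (detPoly α ^ l) =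
      (⨆ s : Fin (l + 1), cyclic 2 (hwVec l s) : LieSubmodule ℂ (Gl 2) (PolyMat 2)) := by
  have hα1 : 1 + α ≠ 0 := by
    intro h
    rw [show α = -1 by linear_combination h] at hα
    simp at hα
  have hw : detPoly α ^ l ∈ (⨆ s : Fin (l + 1), cyclic 2 (hwVec l s) :
      LieSubmodule ℂ (Gl 2) (PolyMat 2)) := by
    rw [← LieSubmodule.mem_toSubmodule, ← (tensorHom_range_and_uIso l).1]
    exact detPoly_pow_mem_range α l
  refine le_antisymm (cyclic_le.mpr hw) (iSup_le fun s => cyclic_le.mpr ?_)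
  exact hwVec_mem_cyclic (isDominantFamily_hwVec l) hα1 hw s (by omega)
    (coeff_gegenbauerSeries_ne_zero _ (by rwa [norm_neg]) _)

/-- The components with odd `s` are excluded because the power lies in the image of `Sym^l(Sym^2)`;
for even `s` the pairing is nonzero. -/
theorem cyclic_permanent_pow (l : ℕ) :
    cyclic 2 (detPoly 1 ^ l) =
      (⨆ j : Fin (l / 2 + 1), cyclic 2 (hwVec l (2 * j)) :
        LieSubmodule ℂ (Gl 2) (PolyMat 2)) := by
  have hw : detPoly 1 ^ l ∈ (⨆ j : Fin (l / 2 + 1), cyclic 2 (hwVec l (2 * j)) :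
      LieSubmodule ℂ (Gl 2) (PolyMat 2)) := by
    rw [← LieSubmodule.mem_toSubmodule, ← (symPowHom_range_and_uIso l).1]
    exact permanent_pow_mem_range l
  refine le_antisymm (cyclic_le.mpr hw) (iSup_le fun j => cyclic_le.mpr ?_)
  exact hwVec_mem_cyclic (σ := fun j : Fin (l / 2 + 1) => 2 * (j : ℕ))
    (isDominantFamily_hwVec_even l) (by norm_num) hw j (by omega)
    (coeff_two_mul_gegenbauerSeries_ne_zero _ _)

theorem isDominant_det_pow (l : ℕ) : IsDominant (l : ℂ) l 0 ((genX 2).det ^ l) := by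
  have := (isDominantFamily_hwVec l).dominant (Fin.last l)
  simp only [Fin.val_last, hwVec, Nat.sub_self, pow_zero, one_mul, mul_zero] at this
  rw [show 2 * (l : ℂ) - l = l by ring] at this
  rwa [det_eq]

end AlphaDet

end

/-! ### Assembly of the three cases -/

theorem corollary4p4 (l : ℕ) (hl : 0 < l) :
    -- `α` off the unit circle
    (∀ α : ℂ, ‖α‖ ≠ 1 →
      UIso 2 (cyclic 2 (alphaDet α (genX 2) ^ l))
        (SymPow 2 (Nat1 2) l ⊗[ℂ] SymPow 2 (Nat1 2) l)) ∧
    UIso 2 (SymPow 2 (Nat1 2) l ⊗[ℂ] SymPow 2 (Nat1 2) l)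
      (⨁ s : Fin (l + 1), M2 (2 * (l : ℂ) - (s : ℕ)) (s : ℕ)) ∧
    -- the permanent
    UIso 2 (cyclic 2 ((genX 2).permanent ^ l))
      (⨁ j : Fin (l / 2 + 1), M2 (2 * (l : ℂ) - 2 * (j : ℕ)) (2 * (j : ℕ))) ∧
    UIso 2 (⨁ j : Fin (l / 2 + 1), M2 (2 * (l : ℂ) - 2 * (j : ℕ)) (2 * (j : ℕ)))
      (SymPow 2 (SymPow 2 (Nat1 2) 2) l) ∧
    -- the determinant
    (cyclic 2 ((genX 2).det ^ l) : Submodule ℂ (PolyMat 2)) = ℂ ∙ ((genX 2).det ^ l) ∧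
    UIso 2 (cyclic 2 ((genX 2).det ^ l)) (M2 (l : ℂ) (l : ℂ)) := by
  have h1 := isDominantFamily_hwVec l
  have h2 := isDominantFamily_hwVec_even l
  have t1 := (tensorHom_range_and_uIso l).2
  have t2 := (symPowHom_range_and_uIso l).2
  have hdom := isDominant_det_pow l
  refine ⟨fun α hα => ?_, t1.trans h1.uIso_directSum.symm, ?_, h2.uIso_directSum.trans t2.symm,
    ?_, ?_⟩
  · exact (UIso.of_eq ((congrArg (fun f => cyclic 2 (f ^ l)) (alphaDet_eq α)).trans
      (cyclic_detPoly_pow hα l))).trans t1.symm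
  · exact (UIso.of_eq ((congrArg (fun f => cyclic 2 (f ^ l)) permanent_eq).trans
      (cyclic_permanent_pow l))).trans h2.uIso_directSum.symm
  -- The weight difference is `0`, so the spanning family consists of the single vector `F^0 v = v`.
  · refine hdom.cyclic_eq_span.trans ?_
    change Submodule.span ℂ (Set.range fun k : Fin 1 =>
      uAct 2 (PolyMat 2) (eU 1 0 ^ (k : ℕ)) ((genX 2).det ^ l)) = _
    rw [Set.range_unique]
    simp
  · obtain ⟨e⟩ := hdom.exists_hwEquiv
    exact (UIso.of_lieModuleEquiv e).symm
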